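/- Let $d\ge 1$, $\varepsilon>0$, $\kappa\ge 2$ and $M$ be given. There is a constant $C>0$, depending only on $d,\varepsilon,\kappa,M$, such that the following holds for all $X>0$, $T>0$, $\delta>0$ and every kernel $\rho_\delta\ge 0$ on $[0,\delta]$ with $\int_{B_\delta(0)}|s|^2\rho_\delta(|s|)\,ds=2d$. Let $\Omega=(0,X)^d$ and $$\mathcal L_\delta v(x)=\tfrac12\int_{B_\delta(0)}\rho_\delta(|s|)\,\bigl(v(x+s)+v(x-s)-2v(x)\bigr)\,ds .$$ Let $u$ be a solution, $\Omega$-periodic in space, of the nonlocal Allen–Cahn equation $u_t-\varepsilon^2\mathcal L_\delta u+u^3-u=0$ in $\Omega\times(0,T)$ with $u(\cdot,0)=u_0$ on $\overline\Omega$. Assume $\|u_0\|_{L^\infty(\Omega)}\le 1$, $u\in C^2([0,T];C^4_{\rm per}(\overline\Omega))$, and $\|\partial_t^k u(t)\|_{C^4}\le M$ for $0\le k\le 2$, $t\in[0,T]$, where $\|v\|_{C^4}=\max_{0\le k\le 4}\sup_x\|D^kv(x)\|$. Let $N,K_t\ge 1$ be integers, $h=X/N$, $\tau=T/K_t\le 1$,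 $t_n=n\tau$. For $j\in\mathbb Z^d$ put $s_j=hj$, and let $\psi_j(s)=\prod_{k=1}^d\max(0,1-|s_k/h-j_k|)$ be the piecewise $d$-multilinear nodal basis function at $s_j$. Let $I^h$ denote restriction to the mesh nodes $x_i=hi$, and let $D_h$ be the matrix, acting on $X$-periodic mesh functions, of the operator $$\mathcal L_{\delta,h}U(x_i)=\sum_{j\neq0}\frac{U(x_i+s_j)+U(x_i-s_j)-2U(x_i)}{|s_j|^2}\,\|s_j\|_1\,\beta_\delta(s_j),\qquad \beta_\delta(s_j)=\tfrac12\int_{B_\delta(0)}\psi_j(s)\frac{|s|^2}{\|s\|_1}\rho_\delta(|s|)\,ds ,$$ where only the finitely many $j$ with $|j_k|\le\lfloor\delta/h\rfloor+1$ for all $k$ contribute. Put $L_h=-\varepsilon^2D_h+\kappa I$ and $f(U)=(\kappa+1)U-U^{.3}$ (componentwise cube). Let $U^0=I^hu_0$ and let $U^1,\dots,U^{K_t}$ be generated by the ETDRK2 scheme, for $0\le n<K_t$, $$\widetilde U^{n+1}=e^{-L_h\tau}U^n+\int_0^\tau e^{-L_h(\tau-s)}f(U^n)\,ds,$$ $$U^{n+1}=e^{-L_h\tau}U^n+\int_0^\tau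 e^{-L_h(\tau-s)}\Bigl[\bigl(1-\tfrac s\tau\bigr)f(U^n)+\tfrac s\tau f(\widetilde U^{n+1})\Bigr]ds .$$ Then $$\|U^n-I^hu(t_n)\|_\infty\le C\,e^{t_n}(h^2+\tau^2)\qquad\text{for all } 0\le n\le K_t .$$ In particular $C$ does not depend on $\delta$, $h$ or $\tau$. -/

import Mathlib

open MeasureTheory Set
open scoped BoundedContinuousFunction ENNReal

noncomputable section

/-- The space `ℝ^d` with its Euclidean norm. -/
abbrev Euc (d : ℕ) : Type := EuclideanSpace ℝ (Fin d)

/-- `v` is periodic with period `X` in each coordinate direction. -/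
def IsCubePeriodic {d : ℕ} {F : Type*} (X : ℝ) (v : Euc d → F) : Prop :=
  ∀ i : Fin d, Function.Periodic v (EuclideanSpace.single i X)

/-- The open cube `(0, X)^d`. -/
def openCube (d : ℕ) (X : ℝ) : Set (Euc d) := {x | ∀ i, x i ∈ Ioo 0 X}

/-- The closed cube `[0, X]^d`. -/
def closedCube (d : ℕ) (X : ℝ) : Set (Euc d) := {x | ∀ i, x i ∈ Icc 0 X}

theorem IsCubePeriodic.exists_norm_le {d : ℕ} {F : Type*} [SeminormedAddCommGroup F] {X : ℝ}
    (hX : 0 < X) {g : Euc d → F} (hg : IsCubePeriodic X g) (hc : Continuous g) :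
    ∃ C, ∀ x, ‖g x‖ ≤ C := by
  have hK : IsCompact ((fun y : Fin d → ℝ => (WithLp.toLp 2 y : Euc d)) ''
      (Set.pi univ fun _ => Icc 0 X)) :=
    (isCompact_univ_pi fun _ => isCompact_Icc).image (PiLp.continuous_toLp 2 _)
  obtain ⟨C, hC⟩ := hK.exists_bound_of_continuousOn hc.continuousOn
  refine ⟨C, fun x => ?_⟩
  have hper : ∀ (n : Fin d → ℤ) (s : Finset (Fin d)),
      Function.Periodic g (∑ i ∈ s, n i • (EuclideanSpace.single i X : Euc d)) := by
    intro n s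
    induction s using Finset.induction_on with
    | empty => intro x; simp
    | insert a s ha ih =>
      rw [Finset.sum_insert ha]
      exact ((hg a).zsmul (n a)).add_period ih
  set n : Fin d → ℤ := fun i => -⌊x i / X⌋ with hn
  have h1 := hper n Finset.univ x
  rw [← h1]
  apply hC
  refine ⟨fun i => x i - ⌊x i / X⌋ * X, ?_, ?_⟩
  · intro i _
    have h2 := Int.floor_le (x i / X)
    have h3 := Int.lt_floor_add_one (x i / X)
    rw [le_div_iff₀ hX] at h2
    rw [div_lt_iff₀ hX] at h3
    constructor
    · simpa using h2
    · show x i - ⌊x i / X⌋ * X ≤ X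
      linarith
  · ext i
    simp [hn, Finset.sum_apply, Pi.single_apply, sub_eq_add_neg]

theorem IsCubePeriodic.iteratedFDeriv {d : ℕ} {X : ℝ} {v : Euc d → ℝ}
    (hv : IsCubePeriodic X v) (k : ℕ) : IsCubePeriodic X (iteratedFDeriv ℝ k v) := by
  intro i x
  rw [← iteratedFDeriv_comp_add_right]
  congr 1
  exact funext (hv i)

/-- The linear space of all four times continuously differentiable functions on `ℝ^d` that
are `X`-periodic in each coordinate. -/
def perC4Submodule (d : ℕ) (X : ℝ) : Submodule ℝ (Euc d → ℝ) where
  carrier := {v | ContDiff ℝ 4 v ∧ IsCubePeriodic X v}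
  add_mem' := fun ha hb => ⟨ha.1.add hb.1, fun i => (ha.2 i).add (hb.2 i)⟩
  zero_mem' := ⟨contDiff_const, fun _ _ => rfl⟩
  smul_mem' := fun c _ ha =>
    ⟨contDiff_const.smul ha.1, fun i x => congrArg (c * ·) (ha.2 i x)⟩

/-- The space `C⁴_per` of `X`-periodic `C⁴` functions. It is a type of its own, so that it carries
the `C⁴` norm below and not the topology of pointwise convergence. -/
def PerC4 (d : ℕ) (X : ℝ) : Type := ↥(perC4Submodule d X)

namespace PerC4

variable {d : ℕ} {X : ℝ}

instance : AddCommGroup (PerC4 d X) := inferInstanceAs (AddCommGroup ↥(perC4Submodule d X))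

instance : Module ℝ (PerC4 d X) := inferInstanceAs (Module ℝ ↥(perC4Submodule d X))

instance : CoeFun (PerC4 d X) fun _ => Euc d → ℝ := ⟨fun v => v.1⟩

/-- The `k`-th derivative, `k ≤ 4`, as a bounded continuous function. -/
def bddDeriv [hX : Fact (0 < X)] (v : PerC4 d X) (k : Fin 5) :
    Euc d →ᵇ (Euc d [×(k : ℕ)]→L[ℝ] ℝ) :=
  BoundedContinuousFunction.ofNormedAddCommGroup (iteratedFDeriv ℝ (k : ℕ) v.1)
    (v.2.1.continuous_iteratedFDeriv (by exact_mod_cast Nat.lt_succ_iff.mp k.2))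
    (Classical.choose ((v.2.2.iteratedFDeriv k).exists_norm_le hX.out
      (v.2.1.continuous_iteratedFDeriv (by exact_mod_cast Nat.lt_succ_iff.mp k.2))))
    (Classical.choose_spec ((v.2.2.iteratedFDeriv k).exists_norm_le hX.out
      (v.2.1.continuous_iteratedFDeriv (by exact_mod_cast Nat.lt_succ_iff.mp k.2))))

/-- The linear map that sends `v` to its derivatives of orders `0, …, 4`. -/
def jet [Fact (0 < X)] :
    PerC4 d X →ₗ[ℝ] ((k : Fin 5) → (Euc d →ᵇ (Euc d [×(k : ℕ)]→L[ℝ] ℝ))) where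
  toFun v := bddDeriv v
  map_add' v w := by
    funext k
    apply BoundedContinuousFunction.ext
    intro x
    have hk : ((k : ℕ) : WithTop ℕ∞) ≤ 4 := by exact_mod_cast Nat.lt_succ_iff.mp k.2
    exact iteratedFDeriv_add_apply (v.2.1.of_le hk).contDiffAt (w.2.1.of_le hk).contDiffAt
  map_smul' c v := by
    funext k
    apply BoundedContinuousFunction.ext
    intro x
    have hk : ((k : ℕ) : WithTop ℕ∞) ≤ 4 := by exact_mod_cast Nat.lt_succ_iff.mp k.2
    exact iteratedFDeriv_const_smul_apply (v.2.1.of_le hk).contDiffAt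

theorem jet_injective [Fact (0 < X)] : Function.Injective (jet : PerC4 d X →ₗ[ℝ] _) := by
  intro v w h
  apply Subtype.ext
  funext x
  have h1 : iteratedFDeriv ℝ 0 v.1 x = iteratedFDeriv ℝ 0 w.1 x :=
    DFunLike.congr_fun (congrFun h 0) x
  simpa using DFunLike.congr_fun h1 0

/-- The `C⁴` norm `max_{k ≤ 4} sup_x ‖D^k v(x)‖`. -/
instance [Fact (0 < X)] : NormedAddCommGroup (PerC4 d X) :=
  NormedAddCommGroup.induced _ _ (jet : PerC4 d X →ₗ[ℝ] _) jet_injective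

instance [Fact (0 < X)] : NormedSpace ℝ (PerC4 d X) :=
  NormedSpace.induced ℝ _ _ (jet : PerC4 d X →ₗ[ℝ] _)

end PerC4

/-- Admissible kernels `ρ` with horizon `δ` in dimension `d`: nonnegative on `[0, δ]` with
`∫_{B_δ(0)} |s|² ρ(|s|) ds = 2d`. -/
structure IsKernel (d : ℕ) (δ : ℝ) (ρ : ℝ → ℝ) : Prop where
  nonneg : ∀ r ∈ Icc 0 δ, 0 ≤ ρ r
  integrable : IntegrableOn (fun s : Euc d => ‖s‖ ^ 2 * ρ ‖s‖) (Metric.ball 0 δ)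
  moment : ∫ s in Metric.ball (0 : Euc d) δ, ‖s‖ ^ 2 * ρ ‖s‖ = 2 * d

/-- The nonlocal operator
`L_δ v(x) = ½ ∫_{B_δ(0)} ρ(|s|) (v(x+s) + v(x-s) - 2 v(x)) ds`. -/
def nonlocalOp {d : ℕ} (δ : ℝ) (ρ : ℝ → ℝ) (v : Euc d → ℝ) (x : Euc d) : ℝ :=
  (1 / 2) * ∫ s in Metric.ball (0 : Euc d) δ, ρ ‖s‖ * (v (x + s) + v (x - s) - 2 * v x)

/-- `u` solves `u_t - ε² L_δ u + u³ - u = 0` on `(0,X)^d × (0,T)` with initial value `u₀`;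
periodicity in space is part of the type of `u`. -/
structure IsNACSolution {d : ℕ} {X : ℝ} (ε δ : ℝ) (ρ : ℝ → ℝ) (T : ℝ) (u₀ : Euc d → ℝ)
    (u : ℝ → PerC4 d X) : Prop where
  initial : ∀ x ∈ closedCube d X, u 0 x = u₀ x
  equation : ∀ t ∈ Ioo 0 T, ∀ x ∈ openCube d X,
    deriv (fun s => u s x) t - ε ^ 2 * nonlocalOp δ ρ (u t) x + (u t x) ^ 3 - u t x = 0

/-- Indices of the mesh nodes of the periodic cube with `N` nodes in each direction. -/
abbrev Grid (d N : ℕ) : Type := Fin d → ZMod N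

/-- The mesh point `h j` for a multi-index `j`. -/
def meshPoint {d : ℕ} (h : ℝ) (j : Fin d → ℤ) : Euc d := WithLp.toLp 2 fun k => h * j k

/-- The restriction `I^h v` of a function to the mesh with `h = X / N`. -/
def gridRestrict {d : ℕ} (X : ℝ) (N : ℕ) (v : Euc d → ℝ) : Grid d N → ℝ :=
  fun i => v (meshPoint (X / N) fun k => ((i k).val : ℤ))

/-- The `1`-norm of a vector. -/
def oneNorm {d : ℕ} (s : Euc d) : ℝ := ∑ k, |s k|

/-- The piecewise `d`-multilinear nodal basis function at the mesh point `h j`. -/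
def hatFn {d : ℕ} (h : ℝ) (j : Fin d → ℤ) (s : Euc d) : ℝ :=
  ∏ k, max 0 (1 - |s k / h - j k|)

/-- The quadrature weight `β_δ(s_j) = ½ ∫_{B_δ(0)} ψ_j(s) |s|² / ‖s‖₁ ρ(|s|) ds`. -/
def quadWeight {d : ℕ} (δ : ℝ) (ρ : ℝ → ℝ) (h : ℝ) (j : Fin d → ℤ) : ℝ :=
  (1 / 2) * ∫ s in Metric.ball (0 : Euc d) δ, hatFn h j s * (‖s‖ ^ 2 / oneNorm s) * ρ ‖s‖

/-- The nonzero multi-indices `j` with `|j_k| ≤ ⌊δ/h⌋ + 1`: these comprise all `j ≠ 0` for which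
the basis function at `h j` does not vanish identically on the ball of radius `δ`, so that a sum
over them represents the full interpolant on that ball. -/
def stencil (d : ℕ) (δ h : ℝ) : Finset (Fin d → ℤ) :=
  (Fintype.piFinset fun _ => Finset.Icc (-(⌊δ / h⌋ + 1)) (⌊δ / h⌋ + 1)).erase 0

/-- The quadrature based finite difference operator `L_{δ,h}` on periodic mesh functions,
`h = X / N`. -/
def discreteOp (d N : ℕ) (X δ : ℝ) (ρ : ℝ → ℝ) : (Grid d N → ℝ) →ₗ[ℝ] (Grid d N → ℝ) where
  toFun U i := ∑ j ∈ stencil d δ (X / N),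
    (U (fun k => i k + j k) + U (fun k => i k - j k) - 2 * U i) / ‖meshPoint (X / N) j‖ ^ 2 *
      oneNorm (meshPoint (X / N) j) * quadWeight δ ρ (X / N) j
  map_add' U V := by
    funext i
    simp only [Pi.add_apply, ← Finset.sum_add_distrib]
    exact Finset.sum_congr rfl fun j _ => by ring
  map_smul' c U := by
    funext i
    simp only [Pi.smul_apply, smul_eq_mul, RingHom.id_apply, Finset.mul_sum]
    exact Finset.sum_congr rfl fun j _ => by ring

/-- The nonlocal stiffness matrix `D_h`. -/
def stiffness (d N : ℕ) [NeZero N] (X δ : ℝ) (ρ : ℝ → ℝ) : Matrix (Grid d N) (Grid d N) ℝ :=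
  LinearMap.toMatrix' (discreteOp d N X δ ρ)

/-- `L_h = -ε² D_h + κ I`. -/
def stabMatrix (d N : ℕ) [NeZero N] (X δ : ℝ) (ρ : ℝ → ℝ) (ε κ : ℝ) :
    Matrix (Grid d N) (Grid d N) ℝ :=
  -(ε ^ 2 • stiffness d N X δ ρ) + κ • (1 : Matrix (Grid d N) (Grid d N) ℝ)

/-- `f(U) = (κ + 1) U - U^{.3}`, componentwise. -/
def reaction {ι : Type*} (κ : ℝ) (U : ι → ℝ) : ι → ℝ := fun i => (κ + 1) * U i - U i ^ 3

/-- The predictor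
`e^{-Lτ} U + ∫_0^τ e^{-L(τ-s)} f(U) ds`. -/
def etdPredictor {ι : Type*} [Fintype ι] [DecidableEq ι] (L : Matrix ι ι ℝ) (κ τ : ℝ)
    (U : ι → ℝ) : ι → ℝ :=
  (NormedSpace.exp (-(τ • L))).mulVec U +
    ∫ s in (0 : ℝ)..τ, (NormedSpace.exp (-((τ - s) • L))).mulVec (reaction κ U)

/-- One step of the ETDRK2 scheme,
`e^{-Lτ} U + ∫_0^τ e^{-L(τ-s)} [(1 - s/τ) f(U) + (s/τ) f(Ũ)] ds`, with the predictor `Ũ`. -/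
def etdrk2Step {ι : Type*} [Fintype ι] [DecidableEq ι] (L : Matrix ι ι ℝ) (κ τ : ℝ)
    (U : ι → ℝ) : ι → ℝ :=
  (NormedSpace.exp (-(τ • L))).mulVec U +
    ∫ s in (0 : ℝ)..τ, (NormedSpace.exp (-((τ - s) • L))).mulVec
      ((1 - s / τ) • reaction κ U + (s / τ) • reaction κ (etdPredictor L κ τ U))

end

noncomputable section

/-! The numerical and the exact solution both stay in the unit ball of the sup norm, where the
reaction term is Lipschitz. Consistency in space and time, stability of the semigroup and a discrete
Gronwall inequality then give the rate. The two delicate points are uniformity in `δ` and the growth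
factor `e^{t_n}`, whose exponent does not contain `κ`.

Space. The quadrature interpolates (second difference) · ‖y‖₁/|y|² and divides by ‖s‖₁; its error is
integrated against |s|²ρ ds, a measure of mass `2d` for every `δ`. The second difference is split
into the Hessian form and a remainder of fourth order. For the Hessian form the pointwise error need
not be small when |s| is comparable to `h`, but its integral vanishes
(`integral_quadErr_quadratic`): sign changes kill the mixed monomials, permutations make the squares
contribute equally, and their sum |y|² is treated exactly because interpolation reproduces ‖·‖₁. For
the remainder the pointwise error is O(h²) right up to the origin (`abs_interp_sub_le`). Together
these give `abs_discreteOp_sub_nonlocalOp_le`, with a constant free of `δ`.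

Time. Writing `L_h = w - (w - L_h)` with `w - L_h` entrywise nonnegative gives ‖e^{-tL_h}‖ ≤ e^{-κt}
(`norm_semigroup_le`); as |f| ≤ κ on [-1,1], the scheme preserves the unit ball. The exact solution
does so by a maximum principle. Comparison through the variation of constants formula multiplies the
old error by 1 + φ + (κ+1)φτ/2 with φ = ∫₀^τ e^{-κs} ds. Expanding φ cancels `κ` at second order and
leaves at most e^τ + κ²τ³/2. Since the error is at most 2, the cubic excess is charged to the local
error (`norm_etdrk2Step_sub_le`), and Gronwall (`le_mul_exp_of_step`) concludes. -/

/-! ### Interpolation of quotients R/|y|² near the origin. -/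

/-- Interpolation error of `y ↦ R y / ‖y‖² * P y` for a function `R` vanishing to fourth order at
the origin and a weight `P` that the interpolation reproduces. -/
theorem abs_interp_sub_le {E ι : Type*} [NormedAddCommGroup E] [InnerProductSpace ℝ E]
    (J : Finset ι) (w : ι → ℝ) (p : ι → E) (s : E) (η B : ℝ) (R P : E → ℝ) (g : E →L[ℝ] ℝ)
    (hB : 0 ≤ B) (hη : 0 ≤ η) (hw : ∀ j ∈ J, 0 ≤ w j) (hw1 : ∑ j ∈ J, w j = 1)
    (hwp : ∑ j ∈ J, w j • p j = s) (hp : ∀ j ∈ J, w j ≠ 0 → ‖p j - s‖ ≤ η)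
    (hP : ∑ j ∈ J, w j * P (p j) = P s) (hPp : ∀ j ∈ J, w j ≠ 0 → |P (p j) - P s| ≤ η)
    (hPn : ∀ y, ‖y‖ ≤ P y)
    (hR4 : ∀ y, |R y| ≤ B * ‖y‖ ^ 4)
    (hR1 : η ≤ ‖s‖ → ∀ y, ‖y - s‖ ≤ η → |R y - R s| ≤ B * ‖s‖ ^ 3 * η)
    (hR2 : η ≤ ‖s‖ → ∀ y, ‖y - s‖ ≤ η → |R y - R s - g (y - s)| ≤ B * ‖s‖ ^ 2 * η ^ 2) :
    |∑ j ∈ J, w j * (R (p j) / ‖p j‖ ^ 2 * P (p j)) - R s / ‖s‖ ^ 2 * P s|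
      ≤ 54 * B * η ^ 2 * P s := by
  have hP0 : ∀ y, 0 ≤ P y := fun y => (norm_nonneg y).trans (hPn y)
  set A : E → ℝ := fun y => R y / ‖y‖ ^ 2 with hA
  have hAR : ∀ y, ‖y‖ ^ 2 * A y = R y := by
    intro y
    rcases eq_or_ne y 0 with rfl | hy
    · have := hR4 0
      simp at this
      simp [this]
    · have : ‖y‖ ≠ 0 := norm_ne_zero_iff.2 hy
      simp only [hA]
      field_simp
  have hAb : ∀ y, |A y| ≤ B * ‖y‖ ^ 2 := by
    intro y
    simp only [hA, abs_div, abs_pow, abs_norm]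
    apply div_le_of_le_mul₀ (by positivity) (by positivity)
    calc _ ≤ _ := hR4 y
      _ = _ := by ring
  have hwle : ∀ {a : ι → ℝ} {c : ℝ}, (∀ j ∈ J, w j ≠ 0 → |a j| ≤ c) →
      |∑ j ∈ J, w j * a j| ≤ c := by
    intro a c h
    calc |∑ j ∈ J, w j * a j| ≤ ∑ j ∈ J, |w j * a j| := Finset.abs_sum_le_sum_abs _ _
      _ ≤ ∑ j ∈ J, w j * c := by
        apply Finset.sum_le_sum
        intro j hj
        rw [abs_mul, abs_of_nonneg (hw j hj)]
        rcases eq_or_ne (w j) 0 with h0 | h0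
        · simp [h0]
        · exact mul_le_mul_of_nonneg_left (h j hj h0) (hw j hj)
      _ = c := by rw [← Finset.sum_mul, hw1, one_mul]
  change |∑ j ∈ J, w j * (A (p j) * P (p j)) - A s * P s| ≤ _
  -- Within distance `η` of the origin both terms are already O(η²), so no cancellation is needed.
  -- Farther out, cancellation of first-order terms is used.
  rcases lt_or_ge ‖s‖ η with hs | hs
  · have h1 : |∑ j ∈ J, w j * (A (p j) * P (p j))| ≤ 4 * B * η ^ 2 * P s := by
      calc |∑ j ∈ J, w j * (A (p j) * P (p j))| ≤ ∑ j ∈ J, |w j * (A (p j) * P (p j))| :=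
            Finset.abs_sum_le_sum_abs _ _
        _ ≤ ∑ j ∈ J, 4 * B * η ^ 2 * (w j * P (p j)) := by
          apply Finset.sum_le_sum
          intro j hj
          rw [abs_mul, abs_mul, abs_of_nonneg (hw j hj), abs_of_nonneg (hP0 _)]
          rcases eq_or_ne (w j) 0 with h0 | h0
          · simp [h0]
          · have h2 : ‖p j‖ ≤ 2 * η := by
              calc ‖p j‖ = ‖(p j - s) + s‖ := by simp
                _ ≤ ‖p j - s‖ + ‖s‖ := norm_add_le _ _
                _ ≤ 2 * η := by linarith [hp j hj h0]
            have h3 : |A (p j)| ≤ 4 * B * η ^ 2 := by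
              calc _ ≤ _ := hAb _
                _ ≤ B * (2 * η) ^ 2 := by gcongr
                _ = _ := by ring
            calc w j * (|A (p j)| * P (p j)) ≤ w j * (4 * B * η ^ 2 * P (p j)) := by
                  have := hw j hj
                  have := hP0 (p j)
                  gcongr
              _ = _ := by ring
        _ = _ := by rw [← Finset.mul_sum, hP]
    have h4 : |A s * P s| ≤ B * η ^ 2 * P s := by
      rw [abs_mul, abs_of_nonneg (hP0 s)]
      have := hP0 s
      calc _ ≤ B * ‖s‖ ^ 2 * P s := by gcongr; exact hAb s
        _ ≤ _ := by gcongr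
    have h5 : 0 ≤ B * η ^ 2 * P s := mul_nonneg (by positivity) (hP0 s)
    calc _ ≤ _ := abs_sub _ _
      _ ≤ 4 * B * η ^ 2 * P s + B * η ^ 2 * P s := add_le_add h1 h4
      _ ≤ _ := by linarith
  -- Here `s = 0` forces `η = 0`, so every node of nonzero weight is the origin.
  · rcases eq_or_lt_of_le (norm_nonneg s) with hs0 | hs0
    · have hη0 : η = 0 := by linarith
      subst hη0
      have hs1 : s = 0 := norm_eq_zero.1 hs0.symm
      have h1 : ∀ j ∈ J, w j * (A (p j) * P (p j)) = 0 := by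
        intro j hj
        rcases eq_or_ne (w j) 0 with h0 | h0
        · simp [h0]
        · have h2 := hp j hj h0
          have h3 : p j = 0 := by
            rw [hs1, sub_zero] at h2; exact norm_le_zero_iff.1 h2
          simp [hA, h3]
      rw [Finset.sum_eq_zero h1]
      simp [hA, hs1]
    set r := ‖s‖ with hr
    have hpj : ∀ j ∈ J, w j ≠ 0 → ‖p j‖ ≤ 2 * r := by
      intro j hj h0
      calc ‖p j‖ = ‖(p j - s) + s‖ := by simp
        _ ≤ ‖p j - s‖ + ‖s‖ := norm_add_le _ _
        _ ≤ 2 * r := by linarith [hp j hj h0]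
    have hq : ∀ j, ‖p j‖ ^ 2 - r ^ 2 = 2 * inner ℝ s (p j - s) + ‖p j - s‖ ^ 2 := by
      intro j
      have := norm_add_sq_real s (p j - s)
      rw [add_sub_cancel] at this
      rw [this]; ring
    have hq1 : ∀ j ∈ J, w j ≠ 0 → |‖p j‖ ^ 2 - r ^ 2| ≤ 3 * r * η := by
      intro j hj h0
      rw [hq]
      have h1 := abs_real_inner_le_norm s (p j - s)
      have h2 := hp j hj h0
      have h3 : |inner ℝ s (p j - s)| ≤ r * η := h1.trans (by gcongr)
      have h4 : ‖p j - s‖ ^ 2 ≤ r * η := by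
        calc ‖p j - s‖ ^ 2 ≤ η ^ 2 := by gcongr
          _ = η * η := by ring
          _ ≤ _ := by gcongr
      have h5 : 0 ≤ ‖p j - s‖ ^ 2 := by positivity
      rw [abs_le] at h3 ⊢
      constructor <;> nlinarith
    have hA1 : ∀ j ∈ J, w j ≠ 0 → |A (p j) - A s| ≤ 13 * B * r * η := by
      intro j hj h0
      -- Multiplication by r² takes the place of differentiating the quotient; 13 = 1 + 4·3.
      have h1 : r ^ 2 * (A (p j) - A s)
          = (R (p j) - R s) - A (p j) * (‖p j‖ ^ 2 - r ^ 2) := by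
        rw [← hAR (p j), ← hAR s]; ring
      have h2 : |r ^ 2 * (A (p j) - A s)| ≤ r ^ 2 * (13 * B * r * η) := by
        rw [h1]
        have h3 := hR1 hs (p j) (hp j hj h0)
        have h4 : |A (p j)| ≤ 4 * B * r ^ 2 := by
          calc _ ≤ _ := hAb _
            _ ≤ B * (2 * r) ^ 2 := by gcongr; exact hpj j hj h0
            _ = _ := by ring
        calc _ ≤ _ := abs_sub _ _
          _ ≤ B * r ^ 3 * η + 4 * B * r ^ 2 * (3 * r * η) := by
            rw [abs_mul]
            gcongr
            exact hq1 j hj h0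
          _ = _ := by ring
      rw [abs_mul, abs_of_pos (by positivity)] at h2
      exact le_of_mul_le_mul_left h2 (by positivity)
    have hsum : ∀ ℓ : E →L[ℝ] ℝ, ∑ j ∈ J, w j * ℓ (p j - s) = 0 := by
      intro ℓ
      have : ∑ j ∈ J, w j * ℓ (p j - s) = ℓ (∑ j ∈ J, w j • p j) - (∑ j ∈ J, w j) * ℓ s := by
        rw [map_sum, Finset.sum_mul, ← Finset.sum_sub_distrib]
        exact Finset.sum_congr rfl fun j _ => by simp [mul_sub]
      rw [this, hwp, hw1]; ring
    have hqs : |∑ j ∈ J, w j * (‖p j‖ ^ 2 - r ^ 2)| ≤ η ^ 2 := by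
      have : ∑ j ∈ J, w j * (‖p j‖ ^ 2 - r ^ 2)
          = 2 * ∑ j ∈ J, w j * innerSL ℝ s (p j - s) + ∑ j ∈ J, w j * ‖p j - s‖ ^ 2 := by
        rw [Finset.mul_sum, ← Finset.sum_add_distrib]
        exact Finset.sum_congr rfl fun j _ => by rw [hq, innerSL_apply_apply]; ring
      rw [this, hsum, mul_zero, zero_add]
      refine hwle fun j hj h0 => ?_
      rw [abs_of_nonneg (by positivity)]
      have := hp j hj h0
      gcongr
    have hRs : |∑ j ∈ J, w j * (R (p j) - R s)| ≤ B * r ^ 2 * η ^ 2 := by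
      have : ∑ j ∈ J, w j * (R (p j) - R s) = ∑ j ∈ J, w j * (R (p j) - R s - g (p j - s)) := by
        rw [← sub_eq_zero, ← Finset.sum_sub_distrib, ← hsum g]
        exact Finset.sum_congr rfl fun j _ => by ring
      rw [this]
      exact hwle fun j hj h0 => hR2 hs (p j) (hp j hj h0)
    have hAs : |∑ j ∈ J, w j * (A (p j) - A s)| ≤ 41 * B * η ^ 2 := by
      -- The first-order parts of `R` and of |·|² average to zero because the weights reproduce
      -- linear functions. Only terms of order η² survive; 41 = 1 + 1 + 13·3.
      have h1 : r ^ 2 * ∑ j ∈ J, w j * (A (p j) - A s)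
          = ∑ j ∈ J, w j * (R (p j) - R s) - A s * ∑ j ∈ J, w j * (‖p j‖ ^ 2 - r ^ 2)
            - ∑ j ∈ J, w j * ((A (p j) - A s) * (‖p j‖ ^ 2 - r ^ 2)) := by
        rw [Finset.mul_sum, Finset.mul_sum, ← Finset.sum_sub_distrib, ← Finset.sum_sub_distrib]
        refine Finset.sum_congr rfl fun j _ => ?_
        rw [← hAR (p j), ← hAR s]; ring
      have h2 : |∑ j ∈ J, w j * ((A (p j) - A s) * (‖p j‖ ^ 2 - r ^ 2))|
          ≤ 13 * B * r * η * (3 * r * η) := by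
        refine hwle fun j hj h0 => ?_
        rw [abs_mul]
        have := hA1 j hj h0
        have := hq1 j hj h0
        gcongr
      have h3 : |A s * ∑ j ∈ J, w j * (‖p j‖ ^ 2 - r ^ 2)| ≤ B * r ^ 2 * η ^ 2 := by
        rw [abs_mul]
        have := hAb s
        gcongr
      have h4 : |r ^ 2 * ∑ j ∈ J, w j * (A (p j) - A s)| ≤ r ^ 2 * (41 * B * η ^ 2) := by
        rw [h1]
        calc _ ≤ _ := (abs_sub _ _).trans (add_le_add_left (abs_sub _ _) _)
          _ ≤ B * r ^ 2 * η ^ 2 + B * r ^ 2 * η ^ 2 + 13 * B * r * η * (3 * r * η) :=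
            add_le_add (add_le_add hRs h3) h2
          _ = _ := by ring
      rw [abs_mul, abs_of_pos (by positivity)] at h4
      exact le_of_mul_le_mul_left h4 (by positivity)
    have hAP : |∑ j ∈ J, w j * ((A (p j) - A s) * (P (p j) - P s))| ≤ 13 * B * r * η * η := by
      refine hwle fun j hj h0 => ?_
      rw [abs_mul]
      have := hA1 j hj h0
      have := hPp j hj h0
      gcongr
    -- `P` is reproduced exactly, so its variation enters only through the product of two
    -- differences. That adds the last 13 to 41, giving 54.
    have hmain : ∑ j ∈ J, w j * (A (p j) * P (p j)) - A s * P s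
        = P s * ∑ j ∈ J, w j * (A (p j) - A s)
          + ∑ j ∈ J, w j * ((A (p j) - A s) * (P (p j) - P s)) := by
      have h1 : P s * ∑ j ∈ J, w j * (A (p j) - A s)
          + ∑ j ∈ J, w j * ((A (p j) - A s) * (P (p j) - P s))
          = ∑ j ∈ J, w j * (A (p j) * P (p j)) - A s * ∑ j ∈ J, w j * P (p j) := by
        rw [Finset.mul_sum, Finset.mul_sum, ← Finset.sum_add_distrib, ← Finset.sum_sub_distrib]
        exact Finset.sum_congr rfl fun j _ => by ring
      rw [h1, hP]
    rw [hmain]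
    have hrP : r ≤ P s := hPn s
    calc _ ≤ _ := abs_add_le _ _
      _ ≤ P s * (41 * B * η ^ 2) + 13 * B * r * η * η := by
        rw [abs_mul, abs_of_nonneg (hP0 s)]
        have := hP0 s
        gcongr
      _ = P s * (41 * B * η ^ 2) + 13 * B * η ^ 2 * r := by ring
      _ ≤ P s * (41 * B * η ^ 2) + 13 * B * η ^ 2 * P s := by gcongr
      _ = _ := by ring

/-! ### Second differences and their Taylor remainder. -/

/-- The second difference of a `C²` function with bounded second derivative. -/
theorem norm_second_difference_le {E F : Type*} [NormedAddCommGroup E] [NormedSpace ℝ E]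
    [NormedAddCommGroup F] [NormedSpace ℝ F] {f : E → F} (hf : ContDiff ℝ 2 f) {M : ℝ}
    (hM : ∀ y, ‖iteratedFDeriv ℝ 2 f y‖ ≤ M) (x y : E) :
    ‖f (x + y) + f (x - y) - (2 : ℝ) • f x‖ ≤ 2 * M * ‖y‖ ^ 2 := by
  have hM0 : 0 ≤ M := (norm_nonneg _).trans (hM x)
  have hM' : ∀ y, ‖fderiv ℝ (fderiv ℝ f) y‖ ≤ M := fun y => by
    have h := norm_iteratedFDeriv_zero (𝕜 := ℝ) (f := fderiv ℝ (fderiv ℝ f)) (x := y)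
    rw [norm_iteratedFDeriv_fderiv, norm_iteratedFDeriv_fderiv] at h
    exact h ▸ hM y
  have hd : Differentiable ℝ f := hf.differentiable (by norm_num)
  have hd2 : Differentiable ℝ (fderiv ℝ f) :=
    (hf.fderiv_right (m := 1) (by norm_num)).differentiable (by norm_num)
  have h1 : ∀ z ∈ Metric.closedBall (0 : E) ‖y‖,
      HasFDerivWithinAt (fun z => f (x + z) + f (x - z)) (fderiv ℝ f (x + z) - fderiv ℝ f (x - z))
        (Metric.closedBall (0 : E) ‖y‖) z := by
    intro z _
    have h2 : HasFDerivAt (fun z => f (x + z)) (fderiv ℝ f (x + z)) z :=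
      (hasFDerivAt_comp_add_left x).2 (hd (x + z)).hasFDerivAt
    have h3 : HasFDerivAt (fun z => f (x - z)) (-fderiv ℝ f (x - z)) z := by
      have := (hd (x - z)).hasFDerivAt.comp z ((hasFDerivAt_id z).const_sub x)
      refine this.congr_fderiv ?_
      ext w; simp
    exact ((h2.add h3).congr_fderiv (sub_eq_add_neg _ _).symm).hasFDerivWithinAt
  have h4 : ∀ z ∈ Metric.closedBall (0 : E) ‖y‖,
      ‖fderiv ℝ f (x + z) - fderiv ℝ f (x - z)‖ ≤ 2 * M * ‖y‖ := by
    intro z hz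
    have h5 := convex_univ.norm_image_sub_le_of_norm_hasFDerivWithin_le
      (fun a _ => (hd2 a).hasFDerivAt.hasFDerivWithinAt) (fun a _ => hM' a)
      (mem_univ (x - z)) (mem_univ (x + z))
    have h6 : ‖x + z - (x - z)‖ ≤ 2 * ‖y‖ := by
      have : x + z - (x - z) = z + z := by abel
      rw [this]
      have := mem_closedBall_zero_iff.1 hz
      linarith [norm_add_le z z]
    calc _ ≤ _ := h5
      _ ≤ M * (2 * ‖y‖) := by gcongr
      _ = _ := by ring
  have h7 := (convex_closedBall (0 : E) ‖y‖).norm_image_sub_le_of_norm_hasFDerivWithin_le h1 h4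
    (Metric.mem_closedBall_self (norm_nonneg y)) (mem_closedBall_zero_iff.2 le_rfl)
  simp only [add_zero, sub_zero] at h7
  rw [two_smul]
  calc _ ≤ _ := h7
    _ = _ := by ring

/-- The remainder of the second difference of `v` at `x` after subtraction of its quadratic part. -/
def secondDiffRemainder {E : Type*} [NormedAddCommGroup E] [NormedSpace ℝ E] (v : E → ℝ)
    (x y : E) : ℝ :=
  v (x + y) + v (x - y) - 2 * v x - fderiv ℝ (fderiv ℝ v) x y y

/-- The remainder and its gradient `G` vanish at 0, and the derivative of `G` is a second difference
of D²v, hence at most 2M|y|². Integrating twice by the mean value inequality gives orders three and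
four. For the local bounds, `η ≤ ‖s‖` keeps the ball around `s` inside the ball of radius 2‖s‖, and
the linear functional is the gradient at `s`. -/
theorem secondDiffRemainder_bounds {E : Type*} [NormedAddCommGroup E] [NormedSpace ℝ E]
    {v : E → ℝ} (hv : ContDiff ℝ 4 v) {M : ℝ} (hM : ∀ y, ‖iteratedFDeriv ℝ 4 v y‖ ≤ M) (x : E) :
    (∀ y, |secondDiffRemainder v x y| ≤ 16 * M * ‖y‖ ^ 4) ∧
    ∀ (s : E) (η : ℝ), η ≤ ‖s‖ → ∃ g : E →L[ℝ] ℝ, ∀ y, ‖y - s‖ ≤ η →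
      |secondDiffRemainder v x y - secondDiffRemainder v x s| ≤ 16 * M * ‖s‖ ^ 3 * η ∧
      |secondDiffRemainder v x y - secondDiffRemainder v x s - g (y - s)|
        ≤ 16 * M * ‖s‖ ^ 2 * η ^ 2 := by
  have hM0 : 0 ≤ M := (norm_nonneg _).trans (hM x)
  have hv1 : ContDiff ℝ 3 (fderiv ℝ v) := hv.fderiv_right (by norm_num)
  have hv2 : ContDiff ℝ 2 (fderiv ℝ (fderiv ℝ v)) := hv1.fderiv_right (by norm_num)
  have hF : ∀ y, ‖iteratedFDeriv ℝ 2 (fderiv ℝ (fderiv ℝ v)) y‖ ≤ M := by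
    intro y
    rw [norm_iteratedFDeriv_fderiv, norm_iteratedFDeriv_fderiv]
    exact hM y
  have hd : Differentiable ℝ v := hv.differentiable (by norm_num)
  have hd1 : Differentiable ℝ (fderiv ℝ v) := hv1.differentiable (by norm_num)
  set H := fderiv ℝ (fderiv ℝ v) x with hH
  have hsymm : ∀ a b, H a b = H b a := by
    have : IsSymmSndFDerivAt ℝ v x :=
      (hv.contDiffAt (x := x)).isSymmSndFDerivAt (by simp; norm_num)
    exact fun a b => this a b
  set G : E → E →L[ℝ] ℝ := fun y => fderiv ℝ v (x + y) - fderiv ℝ v (x - y) - (2 : ℝ) • H y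
    with hG
  have hRd : ∀ y, HasFDerivAt (secondDiffRemainder v x) (G y) y := by
    intro y
    have h2 : HasFDerivAt (fun z => v (x + z)) (fderiv ℝ v (x + y)) y :=
      
      (hasFDerivAt_comp_add_left x).2 (hd (x + y)).hasFDerivAt
    have h3 : HasFDerivAt (fun z => v (x - z)) _ y :=
      (hd (x - y)).hasFDerivAt.comp y ((hasFDerivAt_id y).const_sub x)
    have h4 : HasFDerivAt (fun z => H z z) _ y := H.hasFDerivAt.clm_apply (hasFDerivAt_id y)
    have h5 := ((h2.add h3).sub_const (2 * v x)).sub h4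
    refine h5.congr_fderiv ?_
    ext w
    simp [hG, hsymm w y]
    ring
  have hGd : ∀ y, HasFDerivAt G (fderiv ℝ (fderiv ℝ v) (x + y) + fderiv ℝ (fderiv ℝ v) (x - y)
      - (2 : ℝ) • H) y := by
    intro y
    have h2 : HasFDerivAt (fun z => fderiv ℝ v (x + z)) (fderiv ℝ (fderiv ℝ v) (x + y)) y :=
      
      (hasFDerivAt_comp_add_left x).2 (hd1 (x + y)).hasFDerivAt
    have h3 : HasFDerivAt (fun z => fderiv ℝ v (x - z)) _ y :=
      (hd1 (x - y)).hasFDerivAt.comp y ((hasFDerivAt_id y).const_sub x)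
    have h4 : HasFDerivAt (fun z => (2 : ℝ) • H z) ((2 : ℝ) • H) y :=
      (H.hasFDerivAt (x := y)).const_smul (2 : ℝ)
    refine ((h2.sub h3).sub h4).congr_fderiv ?_
    ext w z
    simp
  have hGd' : ∀ y, ‖fderiv ℝ (fderiv ℝ v) (x + y) + fderiv ℝ (fderiv ℝ v) (x - y)
      - (2 : ℝ) • H‖ ≤ 2 * M * ‖y‖ ^ 2 := fun y => norm_second_difference_le hv2 hF x y
  have hG3 : ∀ y, ‖G y‖ ≤ 2 * M * ‖y‖ ^ 3 := by
    intro y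
    have h := (convex_closedBall (0 : E) ‖y‖).norm_image_sub_le_of_norm_hasFDerivWithin_le
      (C := 2 * M * ‖y‖ ^ 2) (fun z _ => (hGd z).hasFDerivWithinAt)
      (fun z hz => (hGd' z).trans (by gcongr; exact mem_closedBall_zero_iff.1 hz))
      (Metric.mem_closedBall_self (norm_nonneg y)) (mem_closedBall_zero_iff.2 le_rfl)
    have h0 : G 0 = 0 := by simp [hG]
    rw [h0, sub_zero, sub_zero] at h
    calc _ ≤ _ := h
      _ = _ := by ring
  have hR0 : secondDiffRemainder v x 0 = 0 := by simp [secondDiffRemainder]; ring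
  have hR4 : ∀ y, |secondDiffRemainder v x y| ≤ 2 * M * ‖y‖ ^ 4 := by
    intro y
    have h := (convex_closedBall (0 : E) ‖y‖).norm_image_sub_le_of_norm_hasFDerivWithin_le
      (C := 2 * M * ‖y‖ ^ 3) (fun z _ => (hRd z).hasFDerivWithinAt)
      (fun z hz => (hG3 z).trans (by gcongr; exact mem_closedBall_zero_iff.1 hz))
      (Metric.mem_closedBall_self (norm_nonneg y)) (mem_closedBall_zero_iff.2 le_rfl)
    rw [hR0, sub_zero, sub_zero, Real.norm_eq_abs] at h
    calc _ ≤ _ := h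
      _ = _ := by ring
  -- The three estimates have constants 2M, 2M·2³ and 2M·2²; 16M covers all of them.
  refine ⟨fun y => (hR4 y).trans ?_, fun s η hs => ⟨G s, fun y hy => ?_⟩⟩
  · gcongr; norm_num
  · have hη : 0 ≤ η := (norm_nonneg _).trans hy
    have hball : ∀ z ∈ Metric.closedBall s η, ‖z‖ ≤ 2 * ‖s‖ := by
      intro z hz
      rw [mem_closedBall_iff_norm] at hz
      calc ‖z‖ = ‖(z - s) + s‖ := by simp
        _ ≤ ‖z - s‖ + ‖s‖ := norm_add_le _ _
        _ ≤ _ := by linarith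
    have hym : y ∈ Metric.closedBall s η := mem_closedBall_iff_norm.2 hy
    have hsm : s ∈ Metric.closedBall s η := Metric.mem_closedBall_self hη
    constructor
    · have h := (convex_closedBall s η).norm_image_sub_le_of_norm_hasFDerivWithin_le
        (C := 2 * M * (2 * ‖s‖) ^ 3) (fun z _ => (hRd z).hasFDerivWithinAt)
        (fun z hz => (hG3 z).trans (by gcongr; exact hball z hz)) hsm hym
      rw [Real.norm_eq_abs] at h
      calc _ ≤ _ := h
        _ ≤ 2 * M * (2 * ‖s‖) ^ 3 * η := by gcongr
        _ = _ := by ring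
    · have hGs : ∀ z ∈ Metric.closedBall s η, ‖G z - G s‖ ≤ 2 * M * (2 * ‖s‖) ^ 2 * η := by
        intro z hz
        have h := (convex_closedBall s η).norm_image_sub_le_of_norm_hasFDerivWithin_le
          (C := 2 * M * (2 * ‖s‖) ^ 2) (fun z _ => (hGd z).hasFDerivWithinAt)
          (fun z hz => (hGd' z).trans (by gcongr; exact hball z hz)) hsm hz
        refine h.trans ?_
        have := mem_closedBall_iff_norm.1 hz
        gcongr
      have h := (convex_closedBall s η).norm_image_sub_le_of_norm_hasFDerivWithin_le'
        (fun z _ => (hRd z).hasFDerivWithinAt) hGs hsm hym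
      rw [Real.norm_eq_abs] at h
      calc _ ≤ _ := h
        _ ≤ 2 * M * (2 * ‖s‖) ^ 2 * η * η := by gcongr
        _ = 8 * M * ‖s‖ ^ 2 * η ^ 2 := by ring
        _ ≤ _ := by gcongr; norm_num

/-! ### Multilinear hat functions and what they reproduce. -/

/-- Only the two integers enclosing `x` carry weight, and `|x| < n` keeps both in the summation
range. -/
theorem sum_hat_mul (n : ℤ) (x : ℝ) (hx : |x| < n) (F : ℤ → ℝ) :
    ∑ m ∈ Finset.Icc (-n) n, max 0 (1 - |x - m|) * F m
      = (1 - Int.fract x) * F ⌊x⌋ + Int.fract x * F (⌊x⌋ + 1) := by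
  rw [abs_lt] at hx
  have h0 := Int.floor_le x
  have h1 := Int.lt_floor_add_one x
  have hfr : Int.fract x = x - ⌊x⌋ := rfl
  have ha : -n ≤ ⌊x⌋ := Int.le_floor.2 (by push_cast; linarith)
  have hb : ⌊x⌋ < n := Int.floor_lt.2 hx.2
  have hsub : ({⌊x⌋, ⌊x⌋ + 1} : Finset ℤ) ⊆ Finset.Icc (-n) n := by
    intro m hm
    simp only [Finset.mem_insert, Finset.mem_singleton] at hm
    rw [Finset.mem_Icc]
    omega
  rw [← Finset.sum_subset hsub, Finset.sum_pair (by omega)]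
  · have e1 : max 0 (1 - |x - (⌊x⌋ : ℤ)|) = 1 - Int.fract x := by
      rw [abs_of_nonneg (by linarith), hfr, max_eq_right (by linarith)]
    have e2 : max 0 (1 - |x - ((⌊x⌋ + 1 : ℤ) : ℝ)|) = Int.fract x := by
      push_cast
      rw [abs_of_nonpos (by linarith), hfr, max_eq_right (by linarith)]
      ring
    rw [e1, e2]
  · intro m _ hm
    simp only [Finset.mem_insert, Finset.mem_singleton, not_or] at hm
    have : 1 ≤ |x - m| := by
      rcases lt_or_ge m ⌊x⌋ with h | h
      · have : (m : ℝ) + 1 ≤ ⌊x⌋ := by exact_mod_cast h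
        exact le_trans (by linarith) (le_abs_self _)
      · have : (⌊x⌋ : ℝ) + 1 + 1 ≤ m := by
          have : ⌊x⌋ + 1 + 1 ≤ m := by omega
          exact_mod_cast this
        exact le_trans (by linarith) (neg_le_abs _)
    rw [max_eq_left (by linarith), zero_mul]

theorem sum_hat (n : ℤ) (x : ℝ) (hx : |x| < n) :
    ∑ m ∈ Finset.Icc (-n) n, max 0 (1 - |x - m|) = 1 := by
  have := sum_hat_mul n x hx fun _ => 1
  simpa using this

variable {d : ℕ}

/-- The multi-indices with all entries between `-n` and `n`. -/
def indexBox (d : ℕ) (n : ℤ) : Finset (Fin d → ℤ) :=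
  Fintype.piFinset fun _ => Finset.Icc (-n) n

theorem hatFn_nonneg (h : ℝ) (j : Fin d → ℤ) (s : Euc d) : 0 ≤ hatFn h j s :=
  Finset.prod_nonneg fun _ _ => le_max_left _ _

theorem sum_hatFn_mul {n : ℤ} {h : ℝ} {s : Euc d} (hs : ∀ k, |s k / h| < n) (k : Fin d)
    (F : ℤ → ℝ) :
    ∑ j ∈ indexBox d n, hatFn h j s * F (j k)
      = (1 - Int.fract (s k / h)) * F ⌊s k / h⌋ + Int.fract (s k / h) * F (⌊s k / h⌋ + 1) := by
  have h1 := Finset.prod_univ_sum (fun _ : Fin d => Finset.Icc (-n) n)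
    (fun l m => max 0 (1 - |s l / h - m|) * if l = k then F m else 1)
  have h2 : ∀ j : Fin d → ℤ, ∏ l, (max 0 (1 - |s l / h - j l|) * if l = k then F (j l) else 1)
      = hatFn h j s * F (j k) := by
    intro j
    rw [Finset.prod_mul_distrib, Finset.prod_ite_eq' Finset.univ k (fun l => F (j l))]
    simp [hatFn]
  simp only [h2] at h1
  rw [indexBox, ← h1, Finset.prod_eq_single k]
  · simp only [if_true]
    exact sum_hat_mul n _ (hs k) F
  · intro l _ hl
    simp only [hl, if_false, mul_one]
    exact sum_hat n _ (hs l)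
  · simp

theorem sum_hatFn {n : ℤ} {h : ℝ} {s : Euc d} (hs : ∀ k, |s k / h| < n) :
    ∑ j ∈ indexBox d n, hatFn h j s = 1 := by
  have h1 := Finset.prod_univ_sum (fun _ : Fin d => Finset.Icc (-n) n)
    (fun l m => max 0 (1 - |s l / h - m|))
  rw [indexBox]
  simp only [hatFn]
  rw [← h1]
  exact Finset.prod_eq_one fun l _ => sum_hat n _ (hs l)

theorem sum_hatFn_smul_meshPoint {n : ℤ} {h : ℝ} (hh : h ≠ 0) {s : Euc d}
    (hs : ∀ k, |s k / h| < n) :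
    ∑ j ∈ indexBox d n, hatFn h j s • meshPoint h j = s := by
  ext k
  have h1 := sum_hatFn_mul hs k fun m => h * m
  simp only [WithLp.ofLp_sum, WithLp.ofLp_smul, Finset.sum_apply, Pi.smul_apply, smul_eq_mul,
    meshPoint]
  rw [h1]
  push_cast
  have : Int.fract (s k / h) = s k / h - ⌊s k / h⌋ := rfl
  rw [this]
  field_simp
  ring

/-- The kinks of |s_k| lie at the node 0, so the 1-norm is affine on each mesh cell. This exactness
is the reason for the factor ‖s‖₁ in the quadrature. -/
theorem sum_hatFn_mul_oneNorm {n : ℤ} {h : ℝ} (hh : 0 < h) {s : Euc d}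
    (hs : ∀ k, |s k / h| < n) :
    ∑ j ∈ indexBox d n, hatFn h j s * oneNorm (meshPoint h j) = oneNorm s := by
  simp only [oneNorm, Finset.mul_sum, meshPoint]
  rw [Finset.sum_comm]
  refine Finset.sum_congr rfl fun k _ => ?_
  rw [sum_hatFn_mul hs k fun m => |h * m|]
  have hfr : Int.fract (s k / h) = s k / h - ⌊s k / h⌋ := rfl
  have hsk : s k = h * (s k / h) := by field_simp
  rw [abs_mul, abs_mul, abs_of_pos hh]
  conv_rhs => rw [hsk, abs_mul, abs_of_pos hh]
  have h0 := Int.floor_le (s k / h)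
  have h1 := Int.lt_floor_add_one (s k / h)
  rcases le_or_gt 0 ⌊s k / h⌋ with hf | hf
  · have hf' : (0 : ℝ) ≤ ⌊s k / h⌋ := by exact_mod_cast hf
    push_cast
    rw [abs_of_nonneg hf', abs_of_nonneg (by linarith : (0 : ℝ) ≤ ⌊s k / h⌋ + 1),
      abs_of_nonneg (by linarith : 0 ≤ s k / h), hfr]
    ring
  · have hf' : (⌊s k / h⌋ : ℝ) + 1 ≤ 0 := by exact_mod_cast hf
    push_cast
    rw [abs_of_nonpos (by linarith : (⌊s k / h⌋ : ℝ) ≤ 0), abs_of_nonpos hf',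
      abs_of_nonpos (by linarith : s k / h ≤ 0), hfr]
    ring

theorem oneNorm_nonneg (s : Euc d) : 0 ≤ oneNorm s := Finset.sum_nonneg fun _ _ => abs_nonneg _

theorem norm_le_oneNorm (s : Euc d) : ‖s‖ ≤ oneNorm s := by
  rw [EuclideanSpace.norm_eq]
  apply Real.sqrt_le_iff.2 ⟨oneNorm_nonneg s, ?_⟩
  simp only [Real.norm_eq_abs, oneNorm]
  exact Finset.sum_sq_le_sq_sum_of_nonneg fun _ _ => abs_nonneg _

theorem abs_oneNorm_sub_le (s t : Euc d) : |oneNorm s - oneNorm t| ≤ oneNorm (s - t) := by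
  simp only [oneNorm, ← Finset.sum_sub_distrib]
  exact (Finset.abs_sum_le_sum_abs _ _).trans
    (Finset.sum_le_sum fun k _ => by simpa using abs_abs_sub_abs_le_abs_sub (s k) (t k))

theorem oneNorm_pos {s : Euc d} (hs : s ≠ 0) : 0 < oneNorm s :=
  (norm_pos_iff.2 hs).trans_le (norm_le_oneNorm s)

theorem abs_sub_lt_of_hatFn_ne_zero {h : ℝ} {j : Fin d → ℤ} {s : Euc d} (hj : hatFn h j s ≠ 0)
    (k : Fin d) : |s k / h - j k| < 1 := by
  by_contra hc
  refine hj (Finset.prod_eq_zero (Finset.mem_univ k) (max_eq_left ?_))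
  linarith [not_lt.1 hc]

theorem oneNorm_meshPoint_sub_le {h : ℝ} (hh : 0 < h) {j : Fin d → ℤ} {s : Euc d}
    (hj : hatFn h j s ≠ 0) : oneNorm (meshPoint h j - s) ≤ d * h := by
  calc oneNorm (meshPoint h j - s) ≤ ∑ _k : Fin d, h := by
        refine Finset.sum_le_sum fun k _ => ?_
        have h1 := abs_sub_lt_of_hatFn_ne_zero hj k
        have h2 : (meshPoint h j - s) k = -(h * (s k / h - j k)) := by
          simp only [meshPoint, PiLp.sub_apply]
          field_simp
          ring
        rw [h2, abs_neg, abs_mul, abs_of_pos hh]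
        nlinarith
    _ = d * h := by simp

theorem abs_div_lt_of_norm_lt {δ h : ℝ} (hh : 0 < h) {s : Euc d} (hs : ‖s‖ < δ) (k : Fin d) :
    |s k / h| < ((⌊δ / h⌋ + 1 : ℤ) : ℝ) := by
  rw [abs_div, abs_of_pos hh]
  push_cast
  refine lt_trans ?_ (Int.lt_floor_add_one (δ / h))
  have := (PiLp.norm_apply_le s k).trans_lt hs
  rw [Real.norm_eq_abs] at this
  gcongr

theorem stencil_eq (δ h : ℝ) : stencil d δ h = (indexBox d (⌊δ / h⌋ + 1)).erase 0 := rfl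

theorem meshPoint_zero (h : ℝ) : meshPoint h (0 : Fin d → ℤ) = 0 := by
  ext k; simp [meshPoint]

theorem continuous_hatFn (h : ℝ) (j : Fin d → ℤ) : Continuous (hatFn h j) := by
  unfold hatFn; fun_prop

theorem continuous_oneNorm : Continuous (oneNorm : Euc d → ℝ) := by
  unfold oneNorm; fun_prop

theorem sum_stencil_hatFn_mul_oneNorm {δ h : ℝ} (hh : 0 < h) {s : Euc d} (hs : ‖s‖ < δ) :
    ∑ j ∈ stencil d δ h, hatFn h j s * oneNorm (meshPoint h j) = oneNorm s := by
  -- The node `j = 0` may be dropped because its 1-norm is zero.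
  rw [stencil_eq, Finset.sum_erase, sum_hatFn_mul_oneNorm hh (abs_div_lt_of_norm_lt hh hs)]
  simp [meshPoint_zero, oneNorm]

/-! ### Quadrature error: boundedness and integrability. -/

/-- The pointwise error of the quadrature rule applied to the (second difference) function `φ`,
relative to the measure `‖s‖² ρ(‖s‖) ds`. -/
def quadErr (δ h : ℝ) (φ : Euc d → ℝ) (s : Euc d) : ℝ :=
  (∑ j ∈ stencil d δ h, hatFn h j s *
    (φ (meshPoint h j) / ‖meshPoint h j‖ ^ 2 * oneNorm (meshPoint h j))) / oneNorm s
    - φ s / ‖s‖ ^ 2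

theorem quadErr_add (δ h : ℝ) (φ ψ : Euc d → ℝ) (s : Euc d) :
    quadErr δ h (fun y => φ y + ψ y) s = quadErr δ h φ s + quadErr δ h ψ s := by
  simp only [quadErr, add_div, add_mul, mul_add, Finset.sum_add_distrib]
  ring

theorem quadErr_mul_const (δ h c : ℝ) (φ : Euc d → ℝ) (s : Euc d) :
    quadErr δ h (fun y => φ y * c) s = quadErr δ h φ s * c := by
  simp only [quadErr, sub_mul, div_mul_eq_mul_div, Finset.sum_mul]
  congr 2
  exact Finset.sum_congr rfl fun j _ => by ring

theorem quadErr_sum {ι : Type*} (δ h : ℝ) (J : Finset ι) (φ : ι → Euc d → ℝ) (s : Euc d) :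
    quadErr δ h (fun y => ∑ a ∈ J, φ a y) s = ∑ a ∈ J, quadErr δ h (φ a) s := by
  classical
  induction J using Finset.induction_on with
  | empty => simp [quadErr]
  | insert a J ha ih =>
    simp only [Finset.sum_insert ha]
    rw [quadErr_add, ih]

theorem measurable_quadErr (δ h : ℝ) {φ : Euc d → ℝ} (hφ : Continuous φ) :
    Measurable (quadErr δ h φ) := by
  unfold quadErr
  refine Measurable.sub ?_ (hφ.measurable.div (by fun_prop))
  refine Measurable.div (Finset.measurable_sum _ fun j _ => ?_) continuous_oneNorm.measurable
  exact (continuous_hatFn h j).measurable.mul_const _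

theorem abs_div_norm_sq_le {φ : Euc d → ℝ} {B : ℝ} (hB : ∀ y, |φ y| ≤ B * ‖y‖ ^ 2) (hB0 : 0 ≤ B)
    (s : Euc d) : |φ s / ‖s‖ ^ 2| ≤ B := by
  rw [abs_div, abs_pow, abs_norm]
  exact div_le_of_le_mul₀ (by positivity) hB0 (hB s)

/-- The division by ‖s‖₁ is harmless at the origin: the weights times the nodal 1-norms sum to
exactly ‖s‖₁. This makes the error integrable against |s|²ρ. -/
theorem abs_quadErr_le {δ h : ℝ} (hh : 0 < h) {φ : Euc d → ℝ} {B : ℝ} (hB0 : 0 ≤ B)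
    (hB : ∀ y, |φ y| ≤ B * ‖y‖ ^ 2) {s : Euc d} (hs : ‖s‖ < δ) :
    |quadErr δ h φ s| ≤ 2 * B := by
  have h1 : |(∑ j ∈ stencil d δ h, hatFn h j s *
    (φ (meshPoint h j) / ‖meshPoint h j‖ ^ 2 * oneNorm (meshPoint h j))) / oneNorm s| ≤ B := by
    rw [abs_div, abs_of_nonneg (oneNorm_nonneg s)]
    refine div_le_of_le_mul₀ (oneNorm_nonneg s) hB0 ?_
    calc _ ≤ _ := Finset.abs_sum_le_sum_abs _ _
      _ ≤ ∑ j ∈ stencil d δ h, B * (hatFn h j s * oneNorm (meshPoint h j)) := by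
        refine Finset.sum_le_sum fun j _ => ?_
        rw [abs_mul, abs_mul, abs_of_nonneg (hatFn_nonneg h j s), abs_of_nonneg (oneNorm_nonneg _)]
        calc _ ≤ hatFn h j s * (B * oneNorm (meshPoint h j)) := by
              have := hatFn_nonneg h j s
              have := oneNorm_nonneg (meshPoint h j)
              gcongr
              exact abs_div_norm_sq_le hB hB0 _
          _ = _ := by ring
      _ = B * oneNorm s := by rw [← Finset.mul_sum, sum_stencil_hatFn_mul_oneNorm hh hs]
  calc _ ≤ _ := abs_sub _ _
    _ ≤ B + B := add_le_add h1 (abs_div_norm_sq_le hB hB0 s)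
    _ = _ := by ring

theorem IsKernel.integrableOn_mul {δ : ℝ} {ρ : ℝ → ℝ} (hρ : IsKernel d δ ρ) {f : Euc d → ℝ}
    (hf : Measurable f) {B : ℝ} (hB : ∀ s, ‖s‖ < δ → |f s| ≤ B) :
    IntegrableOn (fun s : Euc d => f s * (‖s‖ ^ 2 * ρ ‖s‖)) (Metric.ball 0 δ) := by
  refine Integrable.bdd_mul (c := B) hρ.integrable hf.aestronglyMeasurable ?_
  filter_upwards [ae_restrict_mem measurableSet_ball] with s hs
  exact hB s (mem_ball_zero_iff.1 hs)

theorem integrableOn_quadErr {δ h : ℝ} (hh : 0 < h) {ρ : ℝ → ℝ} (hρ : IsKernel d δ ρ)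
    {φ : Euc d → ℝ} (hφ : Continuous φ) {B : ℝ} (hB0 : 0 ≤ B) (hB : ∀ y, |φ y| ≤ B * ‖y‖ ^ 2) :
    IntegrableOn (fun s => quadErr δ h φ s * (‖s‖ ^ 2 * ρ ‖s‖)) (Metric.ball 0 δ) :=
  hρ.integrableOn_mul (measurable_quadErr δ h hφ) fun _ hs => abs_quadErr_le hh hB0 hB hs

/-! ### Symmetry: the quadrature is exact on quadratic forms. -/

/-- The linear isometry `s ↦ (c_i s_{σ(i)})_i` for signs `c_i`. -/
def signedPerm (c : Fin d → ℤˣ) (σ : Equiv.Perm (Fin d)) : Euc d ≃ₗᵢ[ℝ] Euc d :=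
  LinearIsometry.toLinearIsometryEquiv (E₁ := Euc d) (F := Euc d)
    { toFun := fun s => WithLp.toLp 2 fun i => ((c i : ℤ) : ℝ) * s (σ i)
      map_add' := fun s t => by ext i; simp [mul_add]
      map_smul' := fun a s => by ext i; simp; ring
      norm_map' := fun s => by
        simp only [EuclideanSpace.norm_eq, LinearMap.coe_mk, AddHom.coe_mk]
        congr 1
        rw [← Equiv.sum_comp σ fun i => ‖s i‖ ^ 2]
        refine Finset.sum_congr rfl fun i _ => ?_
        rcases Int.units_eq_one_or (c i) with h | h <;> simp [h] } rfl

theorem signedPerm_apply (c : Fin d → ℤˣ) (σ : Equiv.Perm (Fin d)) (s : Euc d) (i : Fin d) :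
    signedPerm c σ s i = ((c i : ℤ) : ℝ) * s (σ i) := rfl

theorem abs_unit_mul (c : ℤˣ) (x : ℝ) : |((c : ℤ) : ℝ) * x| = |x| := by
  rcases Int.units_eq_one_or c with h | h <;> simp [h]

theorem oneNorm_signedPerm (c : Fin d → ℤˣ) (σ : Equiv.Perm (Fin d)) (s : Euc d) :
    oneNorm (signedPerm c σ s) = oneNorm s := by
  simp only [oneNorm, signedPerm_apply, abs_unit_mul]
  exact Equiv.sum_comp σ fun i => |s i|

theorem meshPoint_signedPerm (h : ℝ) (c : Fin d → ℤˣ) (σ : Equiv.Perm (Fin d)) (j : Fin d → ℤ) :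
    meshPoint h (fun i => c i * j (σ i)) = signedPerm c σ (meshPoint h j) := by
  ext i
  rw [signedPerm_apply]
  simp [meshPoint]
  ring

theorem hatFn_signedPerm (h : ℝ) (c : Fin d → ℤˣ) (σ : Equiv.Perm (Fin d)) (j : Fin d → ℤ)
    (s : Euc d) : hatFn h (fun i => c i * j (σ i)) (signedPerm c σ s) = hatFn h j s := by
  simp only [hatFn, signedPerm_apply]
  rw [← Equiv.prod_comp σ fun i => max 0 (1 - |s i / h - j i|)]
  refine Finset.prod_congr rfl fun i _ => ?_
  rw [← abs_unit_mul (c i) (s (σ i) / h - j (σ i))]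
  congr 3
  push_cast
  ring

/-- The conditions `hσ` and `hc` make the signed permutation an involution, so it permutes the
stencil and is its own inverse in the reindexing of the sum. -/
theorem quadErr_signedPerm (δ h : ℝ) (c : Fin d → ℤˣ) (σ : Equiv.Perm (Fin d))
    (hσ : ∀ i, σ (σ i) = i) (hc : ∀ i, c i * c (σ i) = 1) (φ : Euc d → ℝ) (s : Euc d) :
    quadErr δ h φ (signedPerm c σ s) = quadErr δ h (fun y => φ (signedPerm c σ y)) s := by
  simp only [quadErr, oneNorm_signedPerm, LinearIsometryEquiv.norm_map]
  congr 2
  have hinv : ∀ j : Fin d → ℤ, (fun i => (c i : ℤ) * ((c (σ i) : ℤ) * j (σ (σ i)))) = j := by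
    intro j
    funext i
    rw [hσ, ← mul_assoc, ← Units.val_mul, hc, Units.val_one, one_mul]
  have hmem : ∀ j ∈ stencil d δ h, (fun i => (c i : ℤ) * j (σ i)) ∈ stencil d δ h := by
    intro j hj
    rw [stencil, Finset.mem_erase] at hj ⊢
    refine ⟨fun h0 => hj.1 ?_, ?_⟩
    · rw [← hinv j]
      funext i
      have := congrFun h0 (σ i)
      simp only [Pi.zero_apply] at this
      simp [this]
    · rw [Fintype.mem_piFinset]
      intro i
      have h1 := Fintype.mem_piFinset.1 hj.2 (σ i)
      rw [Finset.mem_Icc] at h1 ⊢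
      rcases Int.units_eq_one_or (c i) with h | h <;> simp only [h, Units.val_one, Units.val_neg]
        <;> omega
  refine Finset.sum_nbij' (fun j i => (c i : ℤ) * j (σ i)) (fun j i => (c i : ℤ) * j (σ i))
    hmem hmem (fun j _ => hinv j) (fun j _ => hinv j) fun j _ => ?_
  have h1 : signedPerm c σ (signedPerm c σ s) = s := by
    ext i
    rw [signedPerm_apply, signedPerm_apply, hσ, ← mul_assoc, ← Int.cast_mul, ← Units.val_mul, hc]
    simp
  have h2 := hatFn_signedPerm h c σ j (signedPerm c σ s)
  rw [h1] at h2
  have h3 : signedPerm c σ (meshPoint h fun i => c i * j (σ i)) = meshPoint h j := by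
    rw [← meshPoint_signedPerm]
    exact congrArg (meshPoint h) (hinv j)
  have h4 := oneNorm_signedPerm c σ (meshPoint h j)
  have h5 := (signedPerm c σ).norm_map (meshPoint h j)
  rw [← meshPoint_signedPerm] at h4 h5
  rw [h2, h3, h4, h5]

theorem integral_quadErr_signedPerm (δ h : ℝ) (ρ : ℝ → ℝ) (c : Fin d → ℤˣ)
    (σ : Equiv.Perm (Fin d)) (hσ : ∀ i, σ (σ i) = i) (hc : ∀ i, c i * c (σ i) = 1)
    (φ : Euc d → ℝ) :
    ∫ s in Metric.ball (0 : Euc d) δ,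
        quadErr δ h (fun y => φ (signedPerm c σ y)) s * (‖s‖ ^ 2 * ρ ‖s‖)
      = ∫ s in Metric.ball (0 : Euc d) δ, quadErr δ h φ s * (‖s‖ ^ 2 * ρ ‖s‖) := by
  have h1 := (signedPerm c σ).measurePreserving.setIntegral_preimage_emb
    (signedPerm c σ).toHomeomorph.measurableEmbedding
    (fun s => quadErr δ h φ s * (‖s‖ ^ 2 * ρ ‖s‖)) (Metric.ball 0 δ)
  have h2 : signedPerm c σ ⁻¹' Metric.ball 0 δ = Metric.ball 0 δ := by
    rw [LinearIsometryEquiv.preimage_ball, map_zero]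
  rw [h2] at h1
  rw [← h1]
  simp only [quadErr_signedPerm δ h c σ hσ hc, LinearIsometryEquiv.norm_map]

theorem abs_coord_mul_le (k l : Fin d) (y : Euc d) : |y k * y l| ≤ 1 * ‖y‖ ^ 2 := by
  rw [abs_mul, one_mul, sq]
  exact mul_le_mul (PiLp.norm_apply_le y k) (PiLp.norm_apply_le y l) (abs_nonneg _)
    (norm_nonneg _)

/-- For `k ≠ l`, flipping the sign of the `k`-th coordinate shows that the integral equals its own
negative. For `k = l`, transpositions show that all `d` integrals agree, and they sum to zero
because the error for |y|² vanishes pointwise. -/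
theorem integral_quadErr_coord_mul {δ h : ℝ} (hh : 0 < h) {ρ : ℝ → ℝ} (hρ : IsKernel d δ ρ)
    (k l : Fin d) :
    ∫ s in Metric.ball (0 : Euc d) δ, quadErr δ h (fun y => y k * y l) s * (‖s‖ ^ 2 * ρ ‖s‖)
      = 0 := by
  set D : Fin d → Fin d → ℝ := fun k l => ∫ s in Metric.ball (0 : Euc d) δ,
    quadErr δ h (fun y => y k * y l) s * (‖s‖ ^ 2 * ρ ‖s‖) with hD
  change D k l = 0
  by_cases hkl : k = l
  · subst hkl
    have h1 : ∀ m, D m m = D k k := by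
      intro m
      have := integral_quadErr_signedPerm (d := d) δ h ρ 1 (Equiv.swap k m) (by simp) (by simp)
        fun y => y k * y k
      simp only [signedPerm_apply, Equiv.swap_apply_left, Pi.one_apply, Units.val_one,
        Int.cast_one, one_mul] at this
      exact this
    have h2 : ∑ m, D m m = 0 := by
      simp only [hD]
      rw [← integral_finsetSum _ fun m _ => integrableOn_quadErr hh hρ
        (φ := fun y => y m * y m) (by fun_prop) zero_le_one (abs_coord_mul_le m m)]
      refine setIntegral_eq_zero_of_forall_eq_zero fun s hs => ?_
      rw [← Finset.sum_mul, ← quadErr_sum]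
      rcases eq_or_ne s 0 with rfl | hs0
      · simp
      have h3 : ∀ y : Euc d, ∑ m, y m * y m = ‖y‖ ^ 2 := by
        intro y
        rw [EuclideanSpace.norm_sq_eq]
        exact Finset.sum_congr rfl fun m _ => by rw [Real.norm_eq_abs, sq_abs, sq]
      simp only [h3]
      have h4 : quadErr δ h (fun y : Euc d => ‖y‖ ^ 2) s = 0 := by
        have hn : ∀ y : Euc d, ‖y‖ ^ 2 / ‖y‖ ^ 2 * oneNorm y = oneNorm y := by
          intro y
          rcases eq_or_ne y 0 with rfl | hy
          · simp [oneNorm]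
          · rw [div_self (pow_ne_zero _ (norm_ne_zero_iff.2 hy)), one_mul]
        simp only [quadErr, hn]
        rw [sum_stencil_hatFn_mul_oneNorm hh (mem_ball_zero_iff.1 hs),
          div_self (oneNorm_pos hs0).ne', div_self (pow_ne_zero _ (norm_ne_zero_iff.2 hs0)),
          sub_self]
      rw [h4, zero_mul]
    simp only [h1, Finset.sum_const, Finset.card_univ, Fintype.card_fin, nsmul_eq_mul,
      mul_eq_zero] at h2
    rcases h2 with h2 | h2
    · have := k.pos
      have : d = 0 := by exact_mod_cast h2
      omega
    · exact h2
  · have := integral_quadErr_signedPerm (d := d) δ h ρ (fun i => if i = k then -1 else 1)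
      (Equiv.refl _) (by simp) (fun i => by by_cases h : i = k <;> simp [h]) fun y => y k * y l
    simp only [signedPerm_apply, Equiv.refl_apply, if_true, if_neg (Ne.symm hkl), Units.val_one,
      Int.cast_one, one_mul, Units.val_neg, Int.cast_neg, neg_mul] at this
    have h1 : ∀ s : Euc d, quadErr δ h (fun y => -(y k * y l)) s
        = -quadErr δ h (fun y => y k * y l) s := by
      intro s
      have := quadErr_mul_const δ h (-1) (fun y => y k * y l) s
      simpa using this
    simp only [h1, neg_mul, integral_neg] at this
    have h2 : -D k l = D k l := this
    linarith

theorem integral_quadErr_quadratic {δ h : ℝ} (hh : 0 < h) {ρ : ℝ → ℝ} (hρ : IsKernel d δ ρ)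
    (H : Euc d →L[ℝ] Euc d →L[ℝ] ℝ) :
    ∫ s in Metric.ball (0 : Euc d) δ, quadErr δ h (fun y => H y y) s * (‖s‖ ^ 2 * ρ ‖s‖) = 0 := by
  set e := EuclideanSpace.basisFun (Fin d) ℝ with he
  have hH : ∀ y : Euc d, H y y = ∑ k, ∑ l, y k * y l * H (e k) (e l) := by
    intro y
    have hy : y = ∑ k, y k • e k := by
      have := e.sum_repr y
      simpa [he] using this.symm
    conv_lhs => rw [hy]
    simp only [map_sum, map_smul, sum_apply, smul_apply,
      smul_eq_mul, Finset.mul_sum, mul_assoc]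
    rw [Finset.sum_comm]
    exact Finset.sum_congr rfl fun k _ => Finset.sum_congr rfl fun l _ => by ring
  simp only [hH, quadErr_sum, quadErr_mul_const, Finset.sum_mul]
  have hi : ∀ k l : Fin d, IntegrableOn (fun s : Euc d =>
      quadErr δ h (fun y => y k * y l) s * (H (e k)) (e l) * (‖s‖ ^ 2 * ρ ‖s‖))
      (Metric.ball 0 δ) := by
    intro k l
    have := (integrableOn_quadErr hh hρ (φ := fun y => y k * y l) (by fun_prop) zero_le_one
      (abs_coord_mul_le k l)).mul_const (H (e k) (e l))
    refine this.congr (Filter.Eventually.of_forall fun s => ?_)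
    dsimp; ring
  rw [integral_finsetSum _ fun k _ => integrable_finsetSum _ fun l _ => hi k l]
  refine Finset.sum_eq_zero fun k _ => ?_
  rw [integral_finsetSum _ fun l _ => hi k l]
  refine Finset.sum_eq_zero fun l _ => ?_
  have := integral_quadErr_coord_mul hh hρ k l
  calc _ = ∫ s in Metric.ball (0 : Euc d) δ,
        quadErr δ h (fun y => y k * y l) s * (‖s‖ ^ 2 * ρ ‖s‖) * H (e k) (e l) := by
        congr 1; funext s; ring
    _ = 0 := by rw [integral_mul_const, this, zero_mul]

/-! ### Consistency of the quadrature for the nonlocal operator. -/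

/-- The second difference `v(x+y) + v(x-y) - 2 v(x)`. -/
def secondDiff (v : Euc d → ℝ) (x y : Euc d) : ℝ := v (x + y) + v (x - y) - 2 * v x

theorem nonlocalOp_eq (δ : ℝ) (ρ : ℝ → ℝ) (v : Euc d → ℝ) (x : Euc d) :
    nonlocalOp δ ρ v x = (1 / 2) * ∫ s in Metric.ball (0 : Euc d) δ,
      secondDiff v x s / ‖s‖ ^ 2 * (‖s‖ ^ 2 * ρ ‖s‖) := by
  unfold nonlocalOp
  congr 2
  funext s
  rcases eq_or_ne s 0 with rfl | hs
  · simp [secondDiff]; right; ring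
  · have : ‖s‖ ≠ 0 := norm_ne_zero_iff.2 hs
    rw [secondDiff]
    field_simp

theorem abs_secondDiff_le {v : Euc d → ℝ} (hv : ContDiff ℝ 2 v) {M : ℝ}
    (hM : ∀ y, ‖iteratedFDeriv ℝ 2 v y‖ ≤ M) (x y : Euc d) :
    |secondDiff v x y| ≤ 2 * M * ‖y‖ ^ 2 := by
  simpa [secondDiff] using norm_second_difference_le hv hM x y

/-- One term of the sum reproducing ‖s‖₁ is at most the whole sum. This bounds the integrand of each
quadrature weight near the singularity of 1/‖s‖₁. -/
theorem hatFn_div_oneNorm_le {δ h : ℝ} (hh : 0 < h) {j : Fin d → ℤ} (hj : j ∈ stencil d δ h)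
    (hj0 : 0 < oneNorm (meshPoint h j)) {s : Euc d} (hs : ‖s‖ < δ) :
    |hatFn h j s / oneNorm s| ≤ 1 / oneNorm (meshPoint h j) := by
  rw [abs_of_nonneg (div_nonneg (hatFn_nonneg h j s) (oneNorm_nonneg s))]
  apply div_le_of_le_mul₀ (oneNorm_nonneg s) (by positivity)
  rw [one_div_mul_eq_div, le_div_iff₀ hj0, ← sum_stencil_hatFn_mul_oneNorm hh hs]
  exact Finset.single_le_sum (f := fun j => hatFn h j s * oneNorm (meshPoint h j))
    (fun j _ => mul_nonneg (hatFn_nonneg h j s) (oneNorm_nonneg _)) hj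

theorem meshPoint_ne_zero {h : ℝ} (hh : h ≠ 0) {j : Fin d → ℤ} (hj : j ≠ 0) :
    meshPoint h j ≠ 0 := by
  intro h0
  apply hj
  funext k
  have : meshPoint h j k = 0 := by rw [h0]; rfl
  simpa [meshPoint, hh] using this

/-- Sum and integral are interchanged only after factoring out |s|²ρ, since `ρ` alone need not be
integrable. -/
theorem sum_secondDiff_sub_nonlocalOp {δ h : ℝ} (hh : 0 < h) {ρ : ℝ → ℝ} (hρ : IsKernel d δ ρ)
    {v : Euc d → ℝ} (hv : ContDiff ℝ 2 v) {M : ℝ} (hM : ∀ y, ‖iteratedFDeriv ℝ 2 v y‖ ≤ M)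
    (x : Euc d) :
    ∑ j ∈ stencil d δ h, secondDiff v x (meshPoint h j) / ‖meshPoint h j‖ ^ 2
        * oneNorm (meshPoint h j) * quadWeight δ ρ h j - nonlocalOp δ ρ v x
      = (1 / 2) * ∫ s in Metric.ball (0 : Euc d) δ,
          quadErr δ h (secondDiff v x) s * (‖s‖ ^ 2 * ρ ‖s‖) := by
  have hM0 : 0 ≤ 2 * M := by linarith [(norm_nonneg _).trans (hM x)]
  have hc : Continuous (secondDiff v x) := by
    have := hv.continuous
    unfold secondDiff; fun_prop
  have hi : ∀ j ∈ stencil d δ h, IntegrableOn (fun s : Euc d =>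
      (secondDiff v x (meshPoint h j) / ‖meshPoint h j‖ ^ 2 * oneNorm (meshPoint h j))
        * (hatFn h j s / oneNorm s * (‖s‖ ^ 2 * ρ ‖s‖))) (Metric.ball 0 δ) := by
    intro j hj
    have hj0 := oneNorm_pos (meshPoint_ne_zero hh.ne' (Finset.mem_erase.1 hj).1)
    exact (hρ.integrableOn_mul
      ((continuous_hatFn h j).measurable.div continuous_oneNorm.measurable)
      fun s hs => hatFn_div_oneNorm_le hh hj hj0 hs).const_mul _
  have h1 : ∀ j ∈ stencil d δ h, secondDiff v x (meshPoint h j) / ‖meshPoint h j‖ ^ 2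
        * oneNorm (meshPoint h j) * quadWeight δ ρ h j
      = (1 / 2) * ∫ s in Metric.ball (0 : Euc d) δ,
        (secondDiff v x (meshPoint h j) / ‖meshPoint h j‖ ^ 2 * oneNorm (meshPoint h j))
        * (hatFn h j s / oneNorm s * (‖s‖ ^ 2 * ρ ‖s‖)) := by
    intro j _
    rw [integral_const_mul, quadWeight]
    have : ∀ s : Euc d, hatFn h j s * (‖s‖ ^ 2 / oneNorm s) * ρ ‖s‖
        = hatFn h j s / oneNorm s * (‖s‖ ^ 2 * ρ ‖s‖) := fun s => by ring
    simp only [this]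
    ring
  have hi2 : IntegrableOn (fun s : Euc d => secondDiff v x s / ‖s‖ ^ 2 * (‖s‖ ^ 2 * ρ ‖s‖))
      (Metric.ball 0 δ) :=
    hρ.integrableOn_mul (hc.measurable.div (by fun_prop))
      fun s _ => abs_div_norm_sq_le (abs_secondDiff_le hv hM x) hM0 s
  rw [Finset.sum_congr rfl h1, ← Finset.mul_sum, ← integral_finsetSum _ hi, nonlocalOp_eq,
    ← mul_sub, ← integral_sub (integrable_finsetSum _ hi) hi2]
  congr 2
  funext s
  rw [quadErr, sub_mul, Finset.sum_div, Finset.sum_mul]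
  congr 1
  exact Finset.sum_congr rfl fun j _ => by ring

theorem abs_quadErr_secondDiffRemainder_le {δ h : ℝ} (hh : 0 < h) {v : Euc d → ℝ}
    (hv : ContDiff ℝ 4 v) {M : ℝ} (hM : ∀ y, ‖iteratedFDeriv ℝ 4 v y‖ ≤ M) (x : Euc d)
    {s : Euc d} (hs : ‖s‖ < δ) :
    |quadErr δ h (secondDiffRemainder v x) s| ≤ 864 * M * (d * h) ^ 2 := by
  have hM0 : 0 ≤ M := (norm_nonneg _).trans (hM x)
  rcases eq_or_ne s 0 with rfl | hs0
  -- At `s = 0` both quotients are divisions by zero, so the error is 0 by convention.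
  · simp [quadErr, oneNorm]
    positivity
  have hsP := oneNorm_pos hs0
  have hbox := abs_div_lt_of_norm_lt hh hs
  have hη : 0 ≤ d * h := by positivity
  obtain ⟨hR4, hR⟩ := secondDiffRemainder_bounds hv hM x
  have hg : ∃ g : Euc d →L[ℝ] ℝ, d * h ≤ ‖s‖ → ∀ y, ‖y - s‖ ≤ d * h →
      |secondDiffRemainder v x y - secondDiffRemainder v x s| ≤ 16 * M * ‖s‖ ^ 3 * (d * h) ∧
      |secondDiffRemainder v x y - secondDiffRemainder v x s - g (y - s)|
        ≤ 16 * M * ‖s‖ ^ 2 * (d * h) ^ 2 := by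
    by_cases hle : d * h ≤ ‖s‖
    · obtain ⟨g, hg⟩ := hR s (d * h) hle
      exact ⟨g, fun _ => hg⟩
    -- The interpolation lemma wants a functional in every case, but constrains it only when `d * h
    -- ≤ ‖s‖`.
    · exact ⟨0, fun h => absurd h hle⟩
  obtain ⟨g, hg⟩ := hg
  -- The constant is 864 = 54·16, and `d * h` bounds the 1-norm distance from `s` to every active
  -- node.
  have key := abs_interp_sub_le (indexBox d (⌊δ / h⌋ + 1)) (fun j => hatFn h j s) (meshPoint h) s
    (d * h) (16 * M) (secondDiffRemainder v x) oneNorm g (by positivity) hη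
    (fun j _ => hatFn_nonneg h j s) (sum_hatFn hbox) (sum_hatFn_smul_meshPoint hh.ne' hbox)
    (fun j _ hj => (norm_le_oneNorm _).trans (oneNorm_meshPoint_sub_le hh hj))
    (sum_hatFn_mul_oneNorm hh hbox)
    (fun j _ hj => (abs_oneNorm_sub_le _ _).trans (oneNorm_meshPoint_sub_le hh hj))
    norm_le_oneNorm hR4 (fun hle y hy => (hg hle y hy).1) (fun hle y hy => (hg hle y hy).2)
  have h1 : quadErr δ h (secondDiffRemainder v x) s = (∑ j ∈ indexBox d (⌊δ / h⌋ + 1),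
      hatFn h j s * (secondDiffRemainder v x (meshPoint h j) / ‖meshPoint h j‖ ^ 2
        * oneNorm (meshPoint h j)) - secondDiffRemainder v x s / ‖s‖ ^ 2 * oneNorm s)
      / oneNorm s := by
    rw [quadErr, stencil_eq, Finset.sum_erase, sub_div, mul_div_cancel_right₀ _ hsP.ne']
    simp [meshPoint_zero]
  rw [h1, abs_div, abs_of_pos hsP, div_le_iff₀ hsP]
  calc _ ≤ _ := key
    _ = _ := by ring

theorem abs_sum_secondDiff_sub_nonlocalOp_le {δ h : ℝ} (hh : 0 < h) {ρ : ℝ → ℝ}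
    (hρ : IsKernel d δ ρ) {v : Euc d → ℝ} (hv : ContDiff ℝ 4 v) {M : ℝ}
    (hM2 : ∀ y, ‖iteratedFDeriv ℝ 2 v y‖ ≤ M) (hM : ∀ y, ‖iteratedFDeriv ℝ 4 v y‖ ≤ M)
    (x : Euc d) :
    |∑ j ∈ stencil d δ h, secondDiff v x (meshPoint h j) / ‖meshPoint h j‖ ^ 2
        * oneNorm (meshPoint h j) * quadWeight δ ρ h j - nonlocalOp δ ρ v x|
      ≤ 864 * d ^ 3 * M * h ^ 2 := by
  have hM0 : 0 ≤ M := (norm_nonneg _).trans (hM x)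
  have hv2 : ContDiff ℝ 2 v := hv.of_le (by norm_num)
  rw [sum_secondDiff_sub_nonlocalOp hh hρ hv2 hM2]
  set H := fderiv ℝ (fderiv ℝ v) x with hH
  have hc : Continuous (secondDiff v x) := by
    have := hv.continuous
    unfold secondDiff; fun_prop
  have hS := integrableOn_quadErr hh hρ hc (by positivity) (abs_secondDiff_le hv2 hM2 x)
  have hQ : IntegrableOn (fun s => quadErr δ h (fun y => H y y) s * (‖s‖ ^ 2 * ρ ‖s‖))
      (Metric.ball (0 : Euc d) δ) := by
    refine integrableOn_quadErr hh hρ (by fun_prop) (norm_nonneg H) fun y => ?_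
    calc _ ≤ _ := H.le_opNorm₂ y y
      _ = _ := by ring
  have hsub : ∀ s, quadErr δ h (secondDiff v x) s
      = quadErr δ h (fun y => H y y) s + quadErr δ h (secondDiffRemainder v x) s := by
    intro s
    rw [← quadErr_add]
    congr 1
    funext y
    simp only [secondDiff, secondDiffRemainder, ← hH]
    ring
  have hR : IntegrableOn (fun s => quadErr δ h (secondDiffRemainder v x) s * (‖s‖ ^ 2 * ρ ‖s‖))
      (Metric.ball (0 : Euc d) δ) := by
    refine (hS.sub hQ).congr (Filter.Eventually.of_forall fun s => ?_)
    simp only [Pi.sub_apply, hsub]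
    ring
  simp only [hsub, add_mul]
  rw [integral_add hQ hR, integral_quadErr_quadratic hh hρ, zero_add]
  have hle : |∫ s in Metric.ball (0 : Euc d) δ,
      quadErr δ h (secondDiffRemainder v x) s * (‖s‖ ^ 2 * ρ ‖s‖)|
      ≤ ∫ s in Metric.ball (0 : Euc d) δ, 864 * M * (d * h) ^ 2 * (‖s‖ ^ 2 * ρ ‖s‖) := by
    rw [← Real.norm_eq_abs]
    refine norm_integral_le_of_norm_le (hρ.integrable.const_mul _) ?_
    filter_upwards [ae_restrict_mem measurableSet_ball] with s hs
    have hs' := mem_ball_zero_iff.1 hs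
    have hW : 0 ≤ ‖s‖ ^ 2 * ρ ‖s‖ :=
      mul_nonneg (by positivity) (hρ.nonneg _ ⟨norm_nonneg s, hs'.le⟩)
    rw [norm_mul, Real.norm_eq_abs, Real.norm_eq_abs, abs_of_nonneg hW]
    exact mul_le_mul_of_nonneg_right (abs_quadErr_secondDiffRemainder_le hh hv hM x hs') hW
  rw [integral_const_mul, hρ.moment] at hle
  rw [abs_mul, abs_of_pos (by norm_num : (0 : ℝ) < 1 / 2)]
  -- The total mass `2d` of the measure is the only trace of the kernel, hence the absence of `δ`.
  calc _ ≤ 1 / 2 * (864 * M * (d * h) ^ 2 * (2 * d)) := by gcongr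
    _ = _ := by ring

/-! ### Periodic mesh functions and the consistency bound on the grid. -/

theorem IsCubePeriodic.add_zsmul {F : Type*} {X : ℝ} {g : Euc d → F} (hg : IsCubePeriodic X g)
    (n : Fin d → ℤ) (x : Euc d) :
    g (x + ∑ i, n i • (EuclideanSpace.single i X : Euc d)) = g x := by
  have hper : ∀ s : Finset (Fin d),
      Function.Periodic g (∑ i ∈ s, n i • (EuclideanSpace.single i X : Euc d)) := by
    intro s
    induction s using Finset.induction_on with
    | empty => intro x; simp
    | insert a s ha ih =>
      rw [Finset.sum_insert ha]
      exact ((hg a).zsmul (n a)).add_period ih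
  exact hper _ x

/-- The mesh point of the periodic grid with index `i`. -/
def gridPoint (X : ℝ) (N : ℕ) (i : Grid d N) : Euc d :=
  meshPoint (X / N) fun k => ((i k).val : ℤ)

theorem meshPoint_congr_of_dvd {F : Type*} {X : ℝ} {N : ℕ} [NeZero N] {g : Euc d → F}
    (hg : IsCubePeriodic X g) {a b : Fin d → ℤ} (hab : ∀ k, (N : ℤ) ∣ a k - b k) :
    g (meshPoint (X / N) a) = g (meshPoint (X / N) b) := by
  choose q hq using hab
  rw [← hg.add_zsmul q (meshPoint (X / N) b)]
  congr 1
  ext k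
  have hN : (N : ℝ) ≠ 0 := NeZero.ne _
  have h1 : (a k : ℝ) = b k + N * q k := by
    have : a k = b k + N * q k := by linarith [hq k]
    exact_mod_cast this
  simp [meshPoint, Finset.sum_apply, Pi.single_apply, h1]
  field_simp

theorem gridRestrict_add {X : ℝ} {N : ℕ} [NeZero N] {v : Euc d → ℝ} (hv : IsCubePeriodic X v)
    (i : Grid d N) (j : Fin d → ℤ) :
    gridRestrict X N v (fun k => i k + j k) = v (gridPoint X N i + meshPoint (X / N) j) := by
  have h1 : gridPoint X N i + meshPoint (X / N) j
      = meshPoint (X / N) fun k => ((i k).val : ℤ) + j k := by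
    ext k; simp [gridPoint, meshPoint]; ring
  rw [h1]
  refine meshPoint_congr_of_dvd hv fun k => ?_
  rw [← ZMod.intCast_eq_intCast_iff_dvd_sub]
  simp

theorem abs_discreteOp_sub_nonlocalOp_le {X δ : ℝ} (hX : 0 < X) {N : ℕ} [NeZero N] {ρ : ℝ → ℝ}
    (hρ : IsKernel d δ ρ) {v : Euc d → ℝ} (hv : ContDiff ℝ 4 v) (hper : IsCubePeriodic X v)
    {M : ℝ} (hM2 : ∀ y, ‖iteratedFDeriv ℝ 2 v y‖ ≤ M) (hM : ∀ y, ‖iteratedFDeriv ℝ 4 v y‖ ≤ M)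
    (i : Grid d N) :
    |discreteOp d N X δ ρ (gridRestrict X N v) i - nonlocalOp δ ρ v (gridPoint X N i)|
      ≤ 864 * d ^ 3 * M * (X / N) ^ 2 := by
  have hN : (0 : ℝ) < N := by exact_mod_cast NeZero.pos N
  have h1 := abs_sum_secondDiff_sub_nonlocalOp_le (h := X / N) (by positivity) hρ hv hM2 hM
    (gridPoint X N i)
  refine le_of_eq_of_le ?_ h1
  congr 2
  change ∑ j ∈ stencil d δ (X / N), _ = _
  refine Finset.sum_congr rfl fun j _ => ?_
  have hneg : gridRestrict X N v (fun k => i k - j k)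
      = v (gridPoint X N i - meshPoint (X / N) j) := by
    have h2 := gridRestrict_add hper i (-j)
    have h3 : meshPoint (X / N) (-j) = -meshPoint (X / N) j := by
      ext k; simp [meshPoint]
    rw [h3, ← sub_eq_add_neg] at h2
    rw [← h2]
    congr 1
    funext k
    simp [sub_eq_add_neg]
  rw [gridRestrict_add hper, hneg]
  rfl

/-! ### The matrix semigroup and variation of constants. -/

theorem norm_exp_le_exp_norm {𝔸 : Type*} [NormedRing 𝔸] [NormOneClass 𝔸] [NormedAlgebra ℝ 𝔸]
    [CompleteSpace 𝔸] (x : 𝔸) : ‖NormedSpace.exp x‖ ≤ Real.exp ‖x‖ := by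
  have h1 := NormedSpace.exp_series_hasSum_exp' (𝕂 := ℝ) x
  have h2 := NormedSpace.exp_series_hasSum_exp' (𝕂 := ℝ) ‖x‖
  rw [← Real.exp_eq_exp_ℝ] at h2
  rw [← h1.tsum_eq]
  refine tsum_of_norm_bounded h2 fun n => ?_
  rw [norm_smul, norm_inv, RCLike.norm_natCast, smul_eq_mul]
  gcongr
  exact norm_pow_le x n

section Semigroup

variable {ι : Type*} [Fintype ι] [DecidableEq ι]

/-- Multiplication by a matrix as a continuous linear map. -/
def mulVecCLM : Matrix ι ι ℝ ≃L[ℝ] ((ι → ℝ) →L[ℝ] (ι → ℝ)) :=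
  (Matrix.toLin'.trans LinearMap.toContinuousLinearMap).toContinuousLinearEquiv

theorem mulVecCLM_apply (A : Matrix ι ι ℝ) (v : ι → ℝ) : mulVecCLM A v = A.mulVec v := by
  simp [mulVecCLM]

theorem mulVecCLM_one : mulVecCLM (1 : Matrix ι ι ℝ) = 1 := by
  ext1 v; simp [mulVecCLM_apply]

theorem mulVecCLM_pow (A : Matrix ι ι ℝ) (n : ℕ) : mulVecCLM (A ^ n) = mulVecCLM A ^ n := by
  induction n with
  | zero => simp [mulVecCLM_one]
  | succ n ih =>
    rw [pow_succ, pow_succ, ← ih]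
    ext1 v
    simp [mulVecCLM_apply, Matrix.mulVec_mulVec]

/-- Moves the exponential into the operators on the sup-normed space, where the contraction estimate
is carried out. -/
theorem exp_mulVec (A : Matrix ι ι ℝ) (v : ι → ℝ) :
    (NormedSpace.exp A).mulVec v = NormedSpace.exp (mulVecCLM A) v := by
  rw [← mulVecCLM_apply]
  congr 1
  rw [NormedSpace.exp_eq_tsum ℝ, NormedSpace.exp_eq_tsum ℝ, ContinuousLinearEquiv.map_tsum]
  simp only [map_smul, mulVecCLM_pow]

/-- The semigroup `e^{-tL}`. -/
def semigroup (L : Matrix ι ι ℝ) (t : ℝ) : (ι → ℝ) →L[ℝ] (ι → ℝ) :=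
  NormedSpace.exp (t • -mulVecCLM L)

theorem exp_neg_smul_mulVec (L : Matrix ι ι ℝ) (t : ℝ) (v : ι → ℝ) :
    (NormedSpace.exp (-(t • L))).mulVec v = semigroup L t v := by
  rw [exp_mulVec, map_neg, map_smul, semigroup, smul_neg]

theorem semigroup_zero (L : Matrix ι ι ℝ) : semigroup L 0 = 1 := by
  simp [semigroup]

theorem continuous_semigroup (L : Matrix ι ι ℝ) : Continuous (semigroup L) :=
  continuous_iff_continuousAt.2 fun t =>
    (hasDerivAt_exp_smul_const (-mulVecCLM L) t).continuousAt

/-- From e^{-tL} = e^{-wt} e^{t(w-L)} the norm is at most e^{-wt} e^{t(w-κ)}, and `w` drops out. -/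
theorem norm_semigroup_le [Nonempty ι] {L : Matrix ι ι ℝ} {κ w : ℝ}
    (hL : ∀ v, ‖w • v - L.mulVec v‖ ≤ (w - κ) * ‖v‖) {t : ℝ} (ht : 0 ≤ t) :
    ‖semigroup L t‖ ≤ Real.exp (-κ * t) := by
  have h1 : t • -mulVecCLM L = (-w * t) • 1 + t • (w • 1 - mulVecCLM L) := by
    module
  have hwκ : 0 ≤ w - κ := by
    have := (norm_nonneg _).trans (hL 1)
    simpa using this
  have h2 : ‖w • 1 - mulVecCLM L‖ ≤ w - κ := by
    refine ContinuousLinearMap.opNorm_le_bound _ hwκ fun v => ?_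
    simpa [mulVecCLM_apply] using hL v
  have h3 : NormedSpace.exp ((-w * t) • (1 : (ι → ℝ) →L[ℝ] (ι → ℝ)))
      = Real.exp (-w * t) • 1 := by
    have := NormedSpace.algebraMap_exp_comm (𝕂 := ℝ) (𝔸 := (ι → ℝ) →L[ℝ] (ι → ℝ)) (-w * t)
    rw [Algebra.algebraMap_eq_smul_one, Algebra.algebraMap_eq_smul_one,
      ← Real.exp_eq_exp_ℝ] at this
    exact this.symm
  have hcomm : Commute ((-w * t) • (1 : (ι → ℝ) →L[ℝ] (ι → ℝ))) (t • (w • 1 - mulVecCLM L)) :=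
    (Commute.one_left _).smul_left _
  let _ : NormedAlgebra ℚ ((ι → ℝ) →L[ℝ] (ι → ℝ)) := NormedAlgebra.restrictScalars ℚ ℝ _
  rw [semigroup, h1, NormedSpace.exp_add_of_commute hcomm, h3, smul_one_mul, norm_smul,
    Real.norm_eq_abs, abs_of_pos (Real.exp_pos _)]
  calc _ ≤ Real.exp (-w * t) * Real.exp (t * (w - κ)) := by
        gcongr
        refine (norm_exp_le_exp_norm _).trans (Real.exp_le_exp.2 ?_)
        rw [norm_smul, Real.norm_eq_abs, abs_of_nonneg ht]
        gcongr
    _ = _ := by rw [← Real.exp_add]; congr 1; ring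

/-- The variation of constants formula. -/
theorem eq_semigroup_add_integral (L : Matrix ι ι ℝ) {τ : ℝ} (hτ : 0 ≤ τ) {y y' : ℝ → ι → ℝ}
    (hy : ContinuousOn y (Icc 0 τ)) (hy' : ContinuousOn y' (Icc 0 τ))
    (hd : ∀ s ∈ Ioo 0 τ, HasDerivAt y (y' s) s) :
    y τ = semigroup L τ (y 0)
      + ∫ s in (0 : ℝ)..τ, semigroup L (τ - s) (y' s + L.mulVec (y s)) := by
  have hc : Continuous fun s => semigroup L (τ - s) :=
    (continuous_semigroup L).comp (continuous_const.sub continuous_id)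
  have hLy : ContinuousOn (fun s => L.mulVec (y s)) (Icc 0 τ) := by
    have := (mulVecCLM L).continuous.comp_continuousOn hy
    refine this.congr fun s _ => (mulVecCLM_apply L (y s)).symm
  have h1 := intervalIntegral.integral_eq_sub_of_hasDerivAt_of_le hτ
    (f := fun s => semigroup L (τ - s) (y s))
    (f' := fun s => semigroup L (τ - s) (y' s + L.mulVec (y s)))
    (hc.continuousOn.clm_apply hy) (fun s hs => ?_)
    (ContinuousOn.intervalIntegrable_of_Icc hτ (hc.continuousOn.clm_apply (hy'.add hLy)))
  · rw [h1]
    simp [semigroup_zero]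
  · have h2 := (hasDerivAt_exp_smul_const (-mulVecCLM L) (τ - s)).scomp s
      ((hasDerivAt_id s).const_sub τ)
    have h3 := h2.clm_apply (hd s hs)
    refine h3.congr_deriv ?_
    simp [semigroup, mulVecCLM_apply]
    abel

/-- The integral of `e^{-κs}` over `[0, τ]`. -/
def phi (κ τ : ℝ) : ℝ := (1 - Real.exp (-κ * τ)) / κ

theorem integral_exp_neg_mul_sub {κ : ℝ} (hκ : κ ≠ 0) (τ : ℝ) :
    ∫ s in (0 : ℝ)..τ, Real.exp (-κ * (τ - s)) = phi κ τ := by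
  have h1 := intervalIntegral.integral_comp_sub_left (a := 0) (b := τ)
    (fun x => Real.exp (-κ * x)) τ
  rw [h1, sub_self, sub_zero, intervalIntegral.integral_comp_mul_left (fun x => Real.exp x)
    (neg_ne_zero.2 hκ), integral_exp, phi]
  simp
  field_simp
  ring

/-- The part `A` keeps the full decay, since its `phi` must later cancel against e^{-κτ}; for the
part `B` the crude bound e^{-κ(τ-s)} ≤ 1 suffices. -/
theorem norm_integral_semigroup_le {L : Matrix ι ι ℝ} {κ τ A B : ℝ} (hκ : 0 < κ) (hτ : 0 < τ)
    (hL : ∀ t, 0 ≤ t → ‖semigroup L t‖ ≤ Real.exp (-κ * t)) (hB : 0 ≤ B)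
    {G : ℝ → ι → ℝ} (hG : ∀ s ∈ Ioo 0 τ, ‖G s‖ ≤ A + s / τ * B) :
    ‖∫ s in (0 : ℝ)..τ, semigroup L (τ - s) (G s)‖ ≤ A * phi κ τ + B * τ / 2 := by
  have h1 : ∫ s in (0 : ℝ)..τ, (Real.exp (-κ * (τ - s)) * A + s / τ * B)
      = A * phi κ τ + B * τ / 2 := by
    rw [intervalIntegral.integral_add (Continuous.intervalIntegrable (by fun_prop) _ _)
      (Continuous.intervalIntegrable (by fun_prop) _ _), intervalIntegral.integral_mul_const,
      intervalIntegral.integral_mul_const, integral_exp_neg_mul_sub hκ.ne',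
      intervalIntegral.integral_div, integral_id]
    field_simp
    ring
  rw [← h1]
  refine intervalIntegral.norm_integral_le_of_norm_le hτ.le ?_
    (Continuous.intervalIntegrable (by fun_prop) _ _)
  have h2 : ∀ᵐ s : ℝ, s ≠ τ := by simp [ae_iff, measure_singleton]
  filter_upwards [h2] with s hs hs'
  have hs'' : s ∈ Ioo 0 τ := ⟨hs'.1, lt_of_le_of_ne hs'.2 hs⟩
  have h3 := hL (τ - s) (by linarith [hs''.2])
  have h4 : Real.exp (-κ * (τ - s)) ≤ 1 :=
    Real.exp_le_one_iff.2 (by nlinarith [hs''.2])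
  have h5 : 0 ≤ s / τ := div_nonneg hs''.1.le hτ.le
  calc _ ≤ ‖semigroup L (τ - s)‖ * ‖G s‖ := ContinuousLinearMap.le_opNorm _ _
    _ ≤ Real.exp (-κ * (τ - s)) * (A + s / τ * B) := by
      gcongr
      exact hG s hs''
    _ = Real.exp (-κ * (τ - s)) * A + Real.exp (-κ * (τ - s)) * (s / τ * B) := by ring
    _ ≤ Real.exp (-κ * (τ - s)) * A + 1 * (s / τ * B) := by gcongr
    _ = _ := by ring

theorem etdPredictor_eq (L : Matrix ι ι ℝ) (κ τ : ℝ) (U : ι → ℝ) :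
    etdPredictor L κ τ U = semigroup L τ U
      + ∫ s in (0 : ℝ)..τ, semigroup L (τ - s) (reaction κ U) := by
  simp only [etdPredictor, exp_neg_smul_mulVec]

theorem etdrk2Step_eq (L : Matrix ι ι ℝ) (κ τ : ℝ) (U : ι → ℝ) :
    etdrk2Step L κ τ U = semigroup L τ U
      + ∫ s in (0 : ℝ)..τ, semigroup L (τ - s)
        ((1 - s / τ) • reaction κ U + (s / τ) • reaction κ (etdPredictor L κ τ U)) := by
  simp only [etdrk2Step, exp_neg_smul_mulVec]

end Semigroup

/-! ### Estimates for `phi` and diagonal dominance of the stabilised matrix. -/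

theorem phi_nonneg {κ τ : ℝ} (hκ : 0 < κ) (hτ : 0 ≤ τ) : 0 ≤ phi κ τ :=
  div_nonneg (by linarith [Real.exp_le_one_iff.2 (by nlinarith : -κ * τ ≤ 0)]) hκ.le

theorem exp_add_mul_phi {κ : ℝ} (hκ : κ ≠ 0) (τ : ℝ) :
    Real.exp (-κ * τ) + κ * phi κ τ = 1 := by
  rw [phi]; field_simp; ring

theorem one_sub_add_sq_sub_cube_le_exp_neg {x : ℝ} (hx : 0 ≤ x) :
    1 - x + x ^ 2 / 2 - x ^ 3 / 2 ≤ Real.exp (-x) := by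
  -- For `x > 1` the left side is (1 - x)(1 + x²/2), which is negative.
  rcases le_or_gt x 1 with h1 | h1
  · have h2 := Real.exp_bound (x := -x) (by rwa [abs_neg, abs_of_nonneg hx]) (n := 3) (by norm_num)
    simp only [Finset.sum_range_succ, Finset.sum_range_zero, abs_neg, abs_of_nonneg hx] at h2
    norm_num [Nat.factorial] at h2
    have h3 := neg_le_of_abs_le h2
    have : 0 ≤ x ^ 3 := by positivity
    linarith
  · refine le_trans ?_ (Real.exp_pos _).le
    nlinarith [mul_pos (sub_pos.2 h1) (by positivity : 0 < x ^ 2)]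

theorem phi_le {κ τ : ℝ} (hκ : 0 < κ) (hτ : 0 ≤ τ) :
    phi κ τ ≤ τ - κ * τ ^ 2 / 2 + κ ^ 2 * τ ^ 3 / 2 := by
  rw [phi, div_le_iff₀ hκ]
  have := one_sub_add_sq_sub_cube_le_exp_neg (x := κ * τ) (by positivity)
  rw [← neg_mul] at this
  nlinarith

theorem phi_le_self {κ τ : ℝ} (hκ : 0 < κ) : phi κ τ ≤ τ := by
  rw [phi, div_le_iff₀ hκ]
  linarith [Real.add_one_le_exp (-κ * τ)]

theorem quadWeight_nonneg {δ : ℝ} {ρ : ℝ → ℝ} (hρ : IsKernel d δ ρ) (h : ℝ) (j : Fin d → ℤ) :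
    0 ≤ quadWeight δ ρ h j := by
  refine mul_nonneg (by norm_num) (setIntegral_nonneg measurableSet_ball fun s hs => ?_)
  exact mul_nonneg (mul_nonneg (hatFn_nonneg h j s) (div_nonneg (by positivity) (oneNorm_nonneg s)))
    (hρ.nonneg _ ⟨norm_nonneg s, (mem_ball_zero_iff.1 hs).le⟩)

theorem stabMatrix_mulVec (d N : ℕ) [NeZero N] (X δ : ℝ) (ρ : ℝ → ℝ) (ε κ : ℝ)
    (v : Grid d N → ℝ) :
    (stabMatrix d N X δ ρ ε κ).mulVec v = -(ε ^ 2 • discreteOp d N X δ ρ v) + κ • v := by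
  rw [stabMatrix, Matrix.add_mulVec, Matrix.neg_mulVec, Matrix.smul_mulVec, Matrix.smul_mulVec,
    Matrix.one_mulVec, stiffness, LinearMap.toMatrix'_mulVec]

/-- The witness removes the multiples of the identity: `w - L_h` is ε² times a sum of shifts with
coefficients `c j ≥ 0` of total mass (w - κ)/ε². Counting shifts instead of matrix entries makes it
irrelevant whether the stencil wraps around the torus. -/
theorem exists_norm_smul_sub_stabMatrix_le (N : ℕ) [NeZero N] (X : ℝ) {δ : ℝ} {ρ : ℝ → ℝ}
    (hρ : IsKernel d δ ρ) (ε κ : ℝ) :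
    ∃ w, ∀ v, ‖w • v - (stabMatrix d N X δ ρ ε κ).mulVec v‖ ≤ (w - κ) * ‖v‖ := by
  set c : (Fin d → ℤ) → ℝ := fun j => 1 / ‖meshPoint (X / N) j‖ ^ 2 *
      oneNorm (meshPoint (X / N) j) * quadWeight δ ρ (X / N) j with hc
  have hc0 : ∀ j, 0 ≤ c j := fun j => mul_nonneg (mul_nonneg (by positivity) (oneNorm_nonneg _))
    (quadWeight_nonneg hρ _ j)
  refine ⟨κ + ε ^ 2 * ∑ j ∈ stencil d δ (X / N), 2 * c j, fun v => ?_⟩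
  have hW : 0 ≤ ∑ j ∈ stencil d δ (X / N), 2 * c j :=
    Finset.sum_nonneg fun j _ => by linarith [hc0 j]
  rw [add_sub_cancel_left]
  refine (pi_norm_le_iff_of_nonneg (by positivity)).2 fun i => ?_
  have h1 : ((κ + ε ^ 2 * ∑ j ∈ stencil d δ (X / N), 2 * c j) • v
      - (stabMatrix d N X δ ρ ε κ).mulVec v) i
      = ε ^ 2 * ∑ j ∈ stencil d δ (X / N),
        c j * (v (fun k => i k + j k) + v (fun k => i k - j k)) := by
    rw [stabMatrix_mulVec]
    simp only [Pi.sub_apply, Pi.add_apply, Pi.neg_apply, Pi.smul_apply, smul_eq_mul]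
    have h2 : discreteOp d N X δ ρ v i = ∑ j ∈ stencil d δ (X / N),
        c j * (v (fun k => i k + j k) + v (fun k => i k - j k))
        - (∑ j ∈ stencil d δ (X / N), 2 * c j) * v i := by
      rw [Finset.sum_mul, ← Finset.sum_sub_distrib]
      exact Finset.sum_congr rfl fun j _ => by simp only [hc]; ring
    rw [h2]
    ring
  rw [h1, norm_mul, Real.norm_eq_abs, Real.norm_eq_abs, abs_of_nonneg (by positivity), mul_assoc]
  gcongr
  rw [Finset.sum_mul]
  refine (Finset.abs_sum_le_sum_abs _ _).trans (Finset.sum_le_sum fun j _ => ?_)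
  rw [abs_mul, abs_of_nonneg (hc0 j)]
  have h3 : |v (fun k => i k + j k) + v (fun k => i k - j k)| ≤ ‖v‖ + ‖v‖ :=
    (abs_add_le _ _).trans (add_le_add (norm_le_pi_norm v _) (norm_le_pi_norm v _))
  nlinarith [mul_le_mul_of_nonneg_left h3 (hc0 j)]

/-! ### One step of the scheme: maximum bound and error recursion. -/

section Step

variable {ι : Type*} [Fintype ι] {κ : ℝ}

/-- For κ ≥ 2 the cubic is nondecreasing on [-1,1], with values ±κ at the ends. -/
theorem norm_reaction_le (hκ : 2 ≤ κ) {U : ι → ℝ} (hU : ‖U‖ ≤ 1) : ‖reaction κ U‖ ≤ κ := by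
  refine (pi_norm_le_iff_of_nonneg (by linarith)).2 fun i => ?_
  have h1 := abs_le.1 ((norm_le_pi_norm U i).trans hU)
  have h2 : U i ^ 2 ≤ 1 := by nlinarith
  rw [Real.norm_eq_abs, abs_le, reaction]
  constructor <;> nlinarith [sq_nonneg (U i)]

theorem norm_reaction_sub_le (hκ : 2 ≤ κ) {U V : ι → ℝ} (hU : ‖U‖ ≤ 1) (hV : ‖V‖ ≤ 1) :
    ‖reaction κ U - reaction κ V‖ ≤ (κ + 1) * ‖U - V‖ := by
  refine (pi_norm_le_iff_of_nonneg (by positivity)).2 fun i => ?_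
  have h1 := abs_le.1 ((norm_le_pi_norm U i).trans hU)
  have h2 := abs_le.1 ((norm_le_pi_norm V i).trans hV)
  have h3 : (reaction κ U - reaction κ V) i
      = (κ + 1 - (U i ^ 2 + U i * V i + V i ^ 2)) * (U - V) i := by
    simp only [reaction, Pi.sub_apply]; ring
  rw [h3, norm_mul]
  have h4 := norm_le_pi_norm (U - V) i
  have h5 : ‖κ + 1 - (U i ^ 2 + U i * V i + V i ^ 2)‖ ≤ κ + 1 := by
    rw [Real.norm_eq_abs, abs_le]
    constructor
    · nlinarith
    · nlinarith [sq_nonneg (U i + V i), sq_nonneg (U i), sq_nonneg (V i)]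
  gcongr

variable [DecidableEq ι] {L : Matrix ι ι ℝ} {τ : ℝ}

/-- By e^{-κτ} + κφ = 1 the bound is a convex combination of the bounds 1 for `U` and κ/κ for the
reaction. -/
theorem norm_etdPredictor_le (hκ : 2 ≤ κ) (hτ : 0 < τ)
    (hL : ∀ t, 0 ≤ t → ‖semigroup L t‖ ≤ Real.exp (-κ * t)) {U : ι → ℝ} (hU : ‖U‖ ≤ 1) :
    ‖etdPredictor L κ τ U‖ ≤ 1 := by
  have hκ0 : 0 < κ := by linarith
  rw [etdPredictor_eq]
  have h1 : ‖semigroup L τ U‖ ≤ Real.exp (-κ * τ) := by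
    calc _ ≤ _ := (semigroup L τ).le_opNorm U
      _ ≤ Real.exp (-κ * τ) * 1 := by gcongr; exact hL τ hτ.le
      _ = _ := mul_one _
  have h2 := norm_integral_semigroup_le (A := κ) (B := 0) hκ0 hτ hL le_rfl
    (G := fun _ => reaction κ U) fun s _ => by simpa using norm_reaction_le hκ hU
  calc _ ≤ _ := norm_add_le _ _
    _ ≤ Real.exp (-κ * τ) + (κ * phi κ τ + 0 * τ / 2) := add_le_add h1 h2
    _ = 1 := by rw [← exp_add_mul_phi hκ0.ne' τ]; ring

theorem norm_etdrk2Step_le (hκ : 2 ≤ κ) (hτ : 0 < τ)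
    (hL : ∀ t, 0 ≤ t → ‖semigroup L t‖ ≤ Real.exp (-κ * t)) {U : ι → ℝ} (hU : ‖U‖ ≤ 1) :
    ‖etdrk2Step L κ τ U‖ ≤ 1 := by
  have hκ0 : 0 < κ := by linarith
  rw [etdrk2Step_eq]
  have h1 : ‖semigroup L τ U‖ ≤ Real.exp (-κ * τ) := by
    calc _ ≤ _ := (semigroup L τ).le_opNorm U
      _ ≤ Real.exp (-κ * τ) * 1 := by gcongr; exact hL τ hτ.le
      _ = _ := mul_one _
  have h2 := norm_integral_semigroup_le (A := κ) (B := 0) hκ0 hτ hL le_rfl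
    (G := fun s => (1 - s / τ) • reaction κ U + (s / τ) • reaction κ (etdPredictor L κ τ U))
    fun s hs => by
      have h3 : 0 ≤ s / τ := div_nonneg hs.1.le hτ.le
      have h4 : 0 ≤ 1 - s / τ := by
        rw [sub_nonneg, div_le_one hτ]; exact hs.2.le
      have h5 := norm_reaction_le hκ hU
      have h6 := norm_reaction_le hκ (norm_etdPredictor_le hκ hτ hL hU)
      calc _ ≤ _ := norm_add_le _ _
        _ ≤ (1 - s / τ) * κ + (s / τ) * κ := by
          rw [norm_smul, norm_smul, Real.norm_eq_abs, Real.norm_eq_abs, abs_of_nonneg h3,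
            abs_of_nonneg h4]
          gcongr
        _ = _ := by ring
  calc _ ≤ _ := norm_add_le _ _
    _ ≤ Real.exp (-κ * τ) + (κ * phi κ τ + 0 * τ / 2) := add_le_add h1 h2
    _ = 1 := by rw [← exp_add_mul_phi hκ0.ne' τ]; ring

/-- A function that satisfies the semilinear equation up to a residual, compared with a numerical
solution given by a quadrature of the variation of constants formula. -/
theorem norm_add_integral_sub_le (hκ : 2 ≤ κ) (hτ : 0 < τ)
    (hL : ∀ t, 0 ≤ t → ‖semigroup L t‖ ≤ Real.exp (-κ * t)) {y y' : ℝ → ι → ℝ}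
    (hy : ContinuousOn y (Icc 0 τ)) (hy' : ContinuousOn y' (Icc 0 τ))
    (hd : ∀ s ∈ Ioo 0 τ, HasDerivAt y (y' s) s) (U : ι → ℝ) {G : ℝ → ι → ℝ} (hGc : Continuous G)
    {A B : ℝ} (hB : 0 ≤ B)
    (hG : ∀ s ∈ Ioo 0 τ, ‖G s - (y' s + L.mulVec (y s))‖ ≤ A + s / τ * B) :
    ‖semigroup L τ U + (∫ s in (0 : ℝ)..τ, semigroup L (τ - s) (G s)) - y τ‖
      ≤ Real.exp (-κ * τ) * ‖U - y 0‖ + A * phi κ τ + B * τ / 2 := by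
  have hc : Continuous fun s => semigroup L (τ - s) :=
    (continuous_semigroup L).comp (continuous_const.sub continuous_id)
  have hLy : ContinuousOn (fun s => L.mulVec (y s)) (Icc 0 τ) := by
    have := (mulVecCLM L).continuous.comp_continuousOn hy
    refine this.congr fun s _ => (mulVecCLM_apply L (y s)).symm
  have h1 : semigroup L τ U + (∫ s in (0 : ℝ)..τ, semigroup L (τ - s) (G s)) - y τ
      = semigroup L τ (U - y 0)
        + ∫ s in (0 : ℝ)..τ, semigroup L (τ - s) (G s - (y' s + L.mulVec (y s))) := by
    conv_lhs => rw [eq_semigroup_add_integral L hτ.le hy hy' hd]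
    simp only [map_sub]
    have hi : IntervalIntegrable (fun s => semigroup L (τ - s) (y' s + L.mulVec (y s)))
        volume 0 τ :=
      ContinuousOn.intervalIntegrable_of_Icc hτ.le (hc.continuousOn.clm_apply (hy'.add hLy))
    rw [intervalIntegral.integral_sub ((hc.clm_apply hGc).intervalIntegrable _ _) hi]
    abel
  rw [h1, add_assoc]
  refine (norm_add_le _ _).trans (add_le_add ?_
    (norm_integral_semigroup_le (by linarith) hτ hL hB hG))
  exact ((semigroup L τ).le_opNorm _).trans
    (mul_le_mul_of_nonneg_right (hL τ hτ.le) (norm_nonneg _))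

/-- Here `P` measures the drift of the reaction over a step, `Q` its linear interpolation error in
time, and `R` the spatial residual. The coefficient of the old error is e^τ, without `κ`; this is
what gives e^{t_n} in the end. -/
theorem norm_etdrk2Step_sub_le (hκ : 2 ≤ κ) (hτ : 0 < τ) (hτ1 : τ ≤ 1)
    (hL : ∀ t, 0 ≤ t → ‖semigroup L t‖ ≤ Real.exp (-κ * t)) {y y' : ℝ → ι → ℝ}
    (hy : ContinuousOn y (Icc 0 τ)) (hy' : ContinuousOn y' (Icc 0 τ))
    (hd : ∀ s ∈ Ioo 0 τ, HasDerivAt y (y' s) s) {U : ι → ℝ} (hU : ‖U‖ ≤ 1)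
    (hy1 : ∀ s ∈ Icc 0 τ, ‖y s‖ ≤ 1) {P Q R : ℝ}
    (hP : ∀ s ∈ Icc 0 τ, ‖reaction κ (y s) - reaction κ (y 0)‖ ≤ P * τ)
    (hQ : ∀ s ∈ Icc 0 τ, ‖(1 - s / τ) • reaction κ (y 0) + (s / τ) • reaction κ (y τ)
      - reaction κ (y s)‖ ≤ Q * τ ^ 2)
    (hR : ∀ s ∈ Ioo 0 τ, ‖y' s + L.mulVec (y s) - reaction κ (y s)‖ ≤ R) :
    ‖etdrk2Step L κ τ U - y τ‖ ≤ Real.exp τ * ‖U - y 0‖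
      + τ * ((κ ^ 2 + Q + (κ + 1) * P) * τ ^ 2 + (κ + 2) * R) := by
  have hκ0 : 0 < κ := by linarith
  have h0 : (0 : ℝ) ∈ Icc 0 τ := ⟨le_rfl, hτ.le⟩
  have hτm : τ ∈ Icc 0 τ := ⟨hτ.le, le_rfl⟩
  have hP0 : 0 ≤ P := by
    have := (norm_nonneg _).trans (hP 0 h0)
    exact nonneg_of_mul_nonneg_left this hτ
  have hQ0 : 0 ≤ Q := by
    have := (norm_nonneg _).trans (hQ 0 h0)
    exact nonneg_of_mul_nonneg_left this (by positivity)
  have hR0 : 0 ≤ R := (norm_nonneg _).trans (hR (τ / 2) ⟨by linarith, by linarith⟩)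
  set E := ‖U - y 0‖ with hE
  have hE0 : 0 ≤ E := norm_nonneg _
  have hE2 : E ≤ 2 := by
    calc E ≤ ‖U‖ + ‖y 0‖ := norm_sub_le _ _
      _ ≤ 2 := by linarith [hy1 0 h0]
  set φ := phi κ τ with hφ
  have hφ0 : 0 ≤ φ := phi_nonneg hκ0 hτ.le
  have hφτ : φ ≤ τ := phi_le_self hκ0
  have hφ3 : φ ≤ τ - κ * τ ^ 2 / 2 + κ ^ 2 * τ ^ 3 / 2 := phi_le hκ0 hτ.le
  have hexp : Real.exp (-κ * τ) + κ * φ = 1 := exp_add_mul_phi hκ0.ne' τ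
  have hpred : ‖etdPredictor L κ τ U - y τ‖ ≤ (1 + φ) * E + (P * τ + R) * φ := by
    rw [etdPredictor_eq]
    have h1 := norm_add_integral_sub_le hκ hτ hL hy hy' hd U
      (G := fun _ => reaction κ U) continuous_const (A := (κ + 1) * E + P * τ + R) (B := 0) le_rfl
      fun s hs => by
        have hs' : s ∈ Icc 0 τ := ⟨hs.1.le, hs.2.le⟩
        have e : reaction κ U - (y' s + L.mulVec (y s))
            = (reaction κ U - reaction κ (y 0)) - (reaction κ (y s) - reaction κ (y 0))
              - (y' s + L.mulVec (y s) - reaction κ (y s)) := by abel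
        rw [e, mul_zero, add_zero]
        calc _ ≤ _ := (norm_sub_le _ _).trans (add_le_add_left (norm_sub_le _ _) _)
          _ ≤ _ := add_le_add (add_le_add (norm_reaction_sub_le hκ hU (hy1 0 h0)) (hP s hs'))
            (hR s hs)
    refine h1.trans (le_of_eq ?_)
    -- The decay -κφ offsets all but φ of the Lipschitz growth (κ+1)φ.
    rw [show Real.exp (-κ * τ) = 1 - κ * φ by linarith]
    ring
  set E' := ‖etdPredictor L κ τ U - y τ‖ with hE'
  have hstep : ‖etdrk2Step L κ τ U - y τ‖ ≤ Real.exp (-κ * τ) * E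
      + ((κ + 1) * E + Q * τ ^ 2 + R) * φ + ((κ + 1) * (φ * E + (P * τ + R) * φ)) * τ / 2 := by
    rw [etdrk2Step_eq]
    refine norm_add_integral_sub_le hκ hτ hL hy hy' hd U (by fun_prop) (by positivity)
      fun s hs => ?_
    have hs' : s ∈ Icc 0 τ := ⟨hs.1.le, hs.2.le⟩
    have h3 : 0 ≤ s / τ := div_nonneg hs.1.le hτ.le
    have h4 : 0 ≤ 1 - s / τ := by
      rw [sub_nonneg, div_le_one hτ]; exact hs.2.le
    have e : (1 - s / τ) • reaction κ U + (s / τ) • reaction κ (etdPredictor L κ τ U)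
          - (y' s + L.mulVec (y s))
        = ((1 - s / τ) • (reaction κ U - reaction κ (y 0))
            + (s / τ) • (reaction κ (etdPredictor L κ τ U) - reaction κ (y τ)))
          + ((1 - s / τ) • reaction κ (y 0) + (s / τ) • reaction κ (y τ) - reaction κ (y s))
          - (y' s + L.mulVec (y s) - reaction κ (y s)) := by
      simp only [smul_sub]; abel
    rw [e]
    have h5 : ‖(1 - s / τ) • (reaction κ U - reaction κ (y 0))‖ ≤ (1 - s / τ) * ((κ + 1) * E) := by
      rw [norm_smul, Real.norm_eq_abs, abs_of_nonneg h4]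
      exact mul_le_mul_of_nonneg_left (norm_reaction_sub_le hκ hU (hy1 0 h0)) h4
    have h6 : ‖(s / τ) • (reaction κ (etdPredictor L κ τ U) - reaction κ (y τ))‖
        ≤ (s / τ) * ((κ + 1) * ((1 + φ) * E + (P * τ + R) * φ)) := by
      rw [norm_smul, Real.norm_eq_abs, abs_of_nonneg h3]
      refine mul_le_mul_of_nonneg_left ((norm_reaction_sub_le hκ
        (norm_etdPredictor_le hκ hτ hL hU) (hy1 τ hτm)).trans ?_) h3
      gcongr
    calc _ ≤ _ := (norm_sub_le _ _).trans (add_le_add_left ((norm_add_le _ _).trans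
          (add_le_add_left (norm_add_le _ _) _)) _)
      _ ≤ (1 - s / τ) * ((κ + 1) * E) + (s / τ) * ((κ + 1) * ((1 + φ) * E + (P * τ + R) * φ))
          + Q * τ ^ 2 + R := by
        gcongr
        · exact hQ s hs'
        · exact hR s hs
      _ = _ := by ring
  have hq : 1 + τ + τ ^ 2 / 2 ≤ Real.exp τ := Real.quadratic_le_exp_of_nonneg hτ.le
  -- The term -κτ²/2 from `hφ3` cancels the κτ²/2 of the corrector, leaving 1 + τ + τ²/2 ≤ e^τ and a
  -- cubic excess.
  have hfac : 1 + φ + (κ + 1) * φ * τ / 2 ≤ Real.exp τ + κ ^ 2 * τ ^ 3 / 2 := by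
    have : (κ + 1) * φ * τ / 2 ≤ (κ + 1) * τ * τ / 2 := by gcongr
    linarith
  calc _ ≤ _ := hstep
    _ = (1 + φ + (κ + 1) * φ * τ / 2) * E + (Q * τ ^ 2 + R) * φ
        + (κ + 1) * ((P * τ + R) * φ) * τ / 2 := by
      rw [show Real.exp (-κ * τ) = 1 - κ * φ by linarith]
      ring
    _ ≤ (Real.exp τ + κ ^ 2 * τ ^ 3 / 2) * E + (Q * τ ^ 2 + R) * τ
        + (κ + 1) * ((P * τ + R) * τ) * τ / 2 := by gcongr
    _ = Real.exp τ * E + κ ^ 2 * τ ^ 3 / 2 * E + (Q * τ ^ 2 + R) * τ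
        + (κ + 1) * P * τ ^ 3 / 2 + (κ + 1) * R * τ * τ / 2 := by ring
    -- The a priori bound `E ≤ 2` turns the cubic excess into a local error term, and `τ ≤ 1`
    -- absorbs the extra factor on `R`.
    _ ≤ Real.exp τ * E + κ ^ 2 * τ ^ 3 / 2 * 2 + (Q * τ ^ 2 + R) * τ
        + (κ + 1) * P * τ ^ 3 + (κ + 1) * R * τ * 1 := by
      have e1 : 0 ≤ (κ + 1) * P * τ ^ 3 := by positivity
      have e2 : (κ + 1) * R * τ * τ / 2 ≤ (κ + 1) * R * τ * 1 := by
        have : (κ + 1) * R * τ * τ ≤ (κ + 1) * R * τ * 1 := by gcongr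
        have : 0 ≤ (κ + 1) * R * τ * τ := by positivity
        linarith
      have e3 : κ ^ 2 * τ ^ 3 / 2 * E ≤ κ ^ 2 * τ ^ 3 / 2 * 2 := by gcongr
      linarith
    _ = _ := by ring

end Step

/-- A discrete Gronwall inequality. -/
theorem le_mul_exp_of_step {K : ℕ} {τ c : ℝ} (hc : 0 ≤ c) {E : ℕ → ℝ} (h0 : E 0 ≤ 0)
    (hE : ∀ n < K, E (n + 1) ≤ Real.exp τ * E n + τ * c) :
    ∀ n ≤ K, E n ≤ c * Real.exp (n * τ) := by
  -- Subtracting 1 makes the induction close, since τ ≤ e^τ - 1 pays for the new term.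
  have key : ∀ n ≤ K, E n ≤ c * (Real.exp (n * τ) - 1) := by
    intro n
    induction n with
    | zero => intro _; simpa using h0
    | succ n ih =>
      intro hn
      have h1 := ih (by omega)
      have h2 : Real.exp ((n + 1 : ℕ) * τ) = Real.exp τ * Real.exp (n * τ) := by
        rw [← Real.exp_add]; congr 1; push_cast; ring
      have h3 := Real.add_one_le_exp τ
      calc _ ≤ _ := hE n (by omega)
        _ ≤ Real.exp τ * (c * (Real.exp (n * τ) - 1)) + τ * c := by gcongr
        _ ≤ _ := by rw [h2]; nlinarith
  intro n hn
  linarith [key n hn]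

/-! ### Maximum principle for the nonlocal equation. -/

theorem IsCubePeriodic.exists_mem_closedCube {X : ℝ} (hX : 0 < X) (x : Euc d) :
    ∃ x' ∈ closedCube d X, ∀ {F : Type} {g : Euc d → F}, IsCubePeriodic X g → g x = g x' := by
  refine ⟨x + ∑ i, (-⌊x i / X⌋) • (EuclideanSpace.single i X : Euc d), fun i => ?_,
    fun hg => (hg.add_zsmul _ x).symm⟩
  have h2 := Int.floor_le (x i / X)
  have h3 := Int.lt_floor_add_one (x i / X)
  rw [le_div_iff₀ hX] at h2
  rw [div_lt_iff₀ hX] at h3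
  have h4 : (x + ∑ i, (-⌊x i / X⌋) • (EuclideanSpace.single i X : Euc d)) i
      = x i - ⌊x i / X⌋ * X := by
    simp [Finset.sum_apply, Pi.single_apply, sub_eq_add_neg]
  rw [h4]
  constructor <;> linarith

theorem isCompact_closedCube (d : ℕ) (X : ℝ) : IsCompact (closedCube d X) := by
  have hK : IsCompact ((fun y : Fin d → ℝ => (WithLp.toLp 2 y : Euc d)) ''
      (Set.pi univ fun _ => Icc 0 X)) :=
    (isCompact_univ_pi fun _ => isCompact_Icc).image (PiLp.continuous_toLp 2 _)
  convert hK using 1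
  ext x
  constructor
  · exact fun hx => ⟨WithLp.ofLp x, fun i _ => hx i, rfl⟩
  · rintro ⟨y, hy, rfl⟩ i
    exact hy i (mem_univ i)

theorem isOpen_openCube (d : ℕ) (X : ℝ) : IsOpen (openCube d X) := by
  have : openCube d X = ⋂ i, (fun x : Euc d => x i) ⁻¹' Ioo 0 X := by
    ext x; simp [openCube]
  rw [this]
  exact isOpen_iInter_of_finite fun i => isOpen_Ioo.preimage (by fun_prop)

theorem closedCube_subset_closure {X : ℝ} (hX : 0 < X) :
    closedCube d X ⊆ closure (openCube d X) := by
  intro x hx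
  set c : Euc d := WithLp.toLp 2 fun _ => X / 2 with hc
  have h1 : Filter.Tendsto (fun t : ℝ => x + t • (c - x)) (nhdsWithin 0 (Ioi 0)) (nhds x) := by
    have : Continuous fun t : ℝ => x + t • (c - x) := by fun_prop
    have := (this.tendsto 0).mono_left (nhdsWithin_le_nhds (s := Ioi 0))
    simpa using this
  refine mem_closure_of_tendsto h1 ?_
  filter_upwards [Ioo_mem_nhdsGT (zero_lt_one' ℝ)] with t ht i
  have h2 := hx i
  have h3 : (x + t • (c - x)) i = (1 - t) * x i + t * (X / 2) := by
    simp [hc]; ring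
  rw [h3]
  have h4 : 0 < t * (X / 2) := by have := ht.1; positivity
  have h5 : 0 < 1 - t := by linarith [ht.2]
  constructor
  · nlinarith [h2.1, mul_nonneg h5.le h2.1]
  · nlinarith [mul_le_mul_of_nonneg_left h2.2 h5.le]

theorem nonlocalOp_nonpos {δ : ℝ} {ρ : ℝ → ℝ} (hρ : IsKernel d δ ρ) {v : Euc d → ℝ} {x : Euc d}
    (hx : ∀ y, v y ≤ v x) : nonlocalOp δ ρ v x ≤ 0 := by
  refine mul_nonpos_of_nonneg_of_nonpos (by norm_num)
    (setIntegral_nonpos measurableSet_ball fun s hs => ?_)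
  refine mul_nonpos_of_nonneg_of_nonpos
    (hρ.nonneg _ ⟨norm_nonneg s, (mem_ball_zero_iff.1 hs).le⟩) ?_
  linarith [hx (x + s), hx (x - s)]

theorem nonlocalOp_neg (δ : ℝ) (ρ : ℝ → ℝ) (v : Euc d → ℝ) (x : Euc d) :
    nonlocalOp δ ρ (fun y => -v y) x = -nonlocalOp δ ρ v x := by
  rw [nonlocalOp, nonlocalOp, ← mul_neg, ← integral_neg]
  congr 2
  funext s
  ring

theorem continuous_nonlocalOp {δ : ℝ} {ρ : ℝ → ℝ} (hρ : IsKernel d δ ρ) {v : Euc d → ℝ}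
    (hv : ContDiff ℝ 2 v) {M : ℝ} (hM : ∀ y, ‖iteratedFDeriv ℝ 2 v y‖ ≤ M) :
    Continuous (nonlocalOp δ ρ v) := by
  have hvc := hv.continuous
  have hM0 : 0 ≤ 2 * M := by linarith [(norm_nonneg _).trans (hM 0)]
  rw [funext (nonlocalOp_eq δ ρ v)]
  refine continuous_const.mul ?_
  refine continuous_of_dominated (bound := fun s => 2 * M * (‖s‖ ^ 2 * ρ ‖s‖)) (fun x => ?_)
    (fun x => ?_) (hρ.integrable.const_mul _) (Filter.Eventually.of_forall fun s => ?_)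
  · have hc : Continuous (secondDiff v x) := by unfold secondDiff; fun_prop
    exact (hρ.integrableOn_mul (hc.measurable.div (by fun_prop)) fun s _ =>
      abs_div_norm_sq_le (abs_secondDiff_le hv hM x) hM0 s).aestronglyMeasurable
  · filter_upwards [ae_restrict_mem measurableSet_ball] with s hs
    have hW : 0 ≤ ‖s‖ ^ 2 * ρ ‖s‖ :=
      mul_nonneg (by positivity) (hρ.nonneg _ ⟨norm_nonneg s, (mem_ball_zero_iff.1 hs).le⟩)
    rw [norm_mul, Real.norm_eq_abs, Real.norm_eq_abs, abs_of_nonneg hW]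
    exact mul_le_mul_of_nonneg_right (abs_div_norm_sq_le (abs_secondDiff_le hv hM x) hM0 s) hW
  · unfold secondDiff; fun_prop

/-- The maximum principle for the nonlocal Allen–Cahn equation. -/
theorem le_one_of_nonlocalAllenCahn {X T ε δ : ℝ} {ρ : ℝ → ℝ} (hX : 0 < X) (hT : 0 < T)
    (hρ : IsKernel d δ ρ) {w w' : ℝ → Euc d → ℝ}
    (hc : ContinuousOn (fun p : ℝ × Euc d => w p.1 p.2) (Icc 0 T ×ˢ univ))
    (hper : ∀ t, IsCubePeriodic X (w t))
    (hd : ∀ t ∈ Ioo 0 T, ∀ x, HasDerivAt (fun s => w s x) (w' t x) t)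
    (heq : ∀ t ∈ Ioo 0 T, ∀ x ∈ closedCube d X,
      w' t x = ε ^ 2 * nonlocalOp δ ρ (w t) x - w t x ^ 3 + w t x)
    (h0 : ∀ x ∈ closedCube d X, w 0 x ≤ 1) :
    ∀ t ∈ Icc 0 T, ∀ x, w t x ≤ 1 := by
  have hIoo : ∀ t ∈ Ioo 0 T, ∀ x, w t x ≤ 1 := by
    intro t ht x
    obtain ⟨x1, hx1, hx1'⟩ := IsCubePeriodic.exists_mem_closedCube hX x
    rw [hx1' (hper t)]
    -- Stopping at `t < T` ensures that the maximum lies where the time derivative exists. The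
    -- derivative there is nonnegative by slopes from the left, even if `t0 = t`.
    have hcomp : IsCompact (Icc 0 t ×ˢ closedCube d X) :=
      isCompact_Icc.prod (isCompact_closedCube d X)
    obtain ⟨⟨t0, x0⟩, ⟨ht0, hx0⟩, hmax⟩ := hcomp.exists_isMaxOn
      ⟨(t, x1), ⟨⟨ht.1.le, le_rfl⟩, hx1⟩⟩
      (hc.mono (prod_mono (Icc_subset_Icc_right ht.2.le) (subset_univ _)))
    have hmax' : ∀ s ∈ Icc 0 t, ∀ y, w s y ≤ w t0 x0 := by
      intro s hs y
      obtain ⟨y1, hy1, hy1'⟩ := IsCubePeriodic.exists_mem_closedCube hX y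
      rw [hy1' (hper s)]
      exact hmax (show (s, y1) ∈ Icc 0 t ×ˢ closedCube d X from ⟨hs, hy1⟩)
    refine (hmax' t ⟨ht.1.le, le_rfl⟩ x1).trans ?_
    by_contra! hgt
    have ht0pos : 0 < t0 := by
      refine lt_of_le_of_ne ht0.1 fun h => ?_
      have := h0 x0 hx0
      rw [h] at this
      exact absurd this (not_le.2 hgt)
    have ht0' : t0 ∈ Ioo 0 T := ⟨ht0pos, ht0.2.trans_lt ht.2⟩
    have hder : 0 ≤ w' t0 x0 := by
      have h1 := (hasDerivAt_iff_tendsto_slope.1 (hd t0 ht0' x0)).mono_left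
        (nhdsWithin_mono t0 (show Iio t0 ⊆ {t0}ᶜ from fun s hs => ne_of_lt hs))
      refine ge_of_tendsto h1 ?_
      filter_upwards [Ioo_mem_nhdsLT ht0pos] with s hs
      rw [slope_def_field]
      exact div_nonneg_of_nonpos (by linarith [hmax' s ⟨hs.1.le, hs.2.le.trans ht0.2⟩ x0])
        (by linarith [hs.2])
    have hL : nonlocalOp δ ρ (w t0) x0 ≤ 0 := nonlocalOp_nonpos hρ (hmax' t0 ht0)
    rw [heq t0 ht0' x0 hx0] at hder
    have h2 : ε ^ 2 * nonlocalOp δ ρ (w t0) x0 ≤ 0 :=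
      mul_nonpos_of_nonneg_of_nonpos (by positivity) hL
    -- Above 1 the reaction w - w³ is strictly negative, so no perturbation of the maximum is
    -- needed.
    nlinarith [mul_pos (by linarith : 0 < w t0 x0) (by linarith : 0 < w t0 x0 - 1)]
  intro t ht x
  have hcl : closure (Ioo 0 T) = Icc 0 T := closure_Ioo hT.ne
  have hcx : ContinuousOn (fun s => w s x) (closure (Ioo 0 T)) := by
    rw [hcl]
    exact hc.comp (f := fun s => (s, x)) (by fun_prop) fun s hs => ⟨hs, mem_univ _⟩
  rw [← hcl] at ht
  exact le_on_closure (fun s hs => hIoo s hs x) hcx continuousOn_const ht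

/-- An open set of measure zero is empty, so continuity upgrades the almost everywhere bound to the
open cube, and density to the closed one. -/
theorem abs_le_one_of_eLpNorm_le {X : ℝ} (hX : 0 < X) {u₀ v : Euc d → ℝ} (hv : Continuous v)
    (huv : ∀ x ∈ closedCube d X, v x = u₀ x)
    (h : eLpNorm u₀ ∞ (volume.restrict (openCube d X)) ≤ 1) :
    ∀ x ∈ closedCube d X, |v x| ≤ 1 := by
  have hopen := isOpen_openCube d X
  have h1 : ∀ᵐ x ∂volume.restrict (openCube d X), |v x| ≤ 1 := by
    rw [eLpNorm_exponent_top] at h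
    filter_upwards [enorm_ae_le_eLpNormEssSup u₀ (volume.restrict (openCube d X)),
      ae_restrict_mem hopen.measurableSet] with x hx hxc
    have h2 := hx.trans h
    rw [huv x fun i => Ioo_subset_Icc_self (hxc i), ← Real.norm_eq_abs]
    rw [← ofReal_norm, ENNReal.ofReal_le_one] at h2
    exact h2
  have h3 : openCube d X ∩ {x | 1 < |v x|} = ∅ := by
    refine IsOpen.eq_empty_of_measure_zero (μ := volume)
      (hopen.inter (isOpen_lt continuous_const hv.abs)) ?_
    rw [ae_restrict_iff' hopen.measurableSet, ae_iff] at h1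
    refine measure_mono_null (fun x hx => ?_) h1
    simpa using hx
  have h4 : openCube d X ⊆ {x | |v x| ≤ 1} := by
    intro x hx
    by_contra hgt
    have hgt' : 1 < |v x| := lt_of_not_ge hgt
    exact h3.subset ⟨hx, hgt'⟩
  exact (closedCube_subset_closure hX).trans
    (closure_minimal h4 (isClosed_le hv.abs continuous_const))

/-! ### Evaluation in the C⁴ space and Taylor expansion in time. -/

namespace PerC4

variable {X : ℝ}

theorem continuous_apply (v : PerC4 d X) : Continuous v.1 := v.2.1.continuous

variable [Fact (0 < X)]

theorem norm_iteratedFDeriv_le (v : PerC4 d X) (k : Fin 5) (x : Euc d) :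
    ‖iteratedFDeriv ℝ (k : ℕ) v x‖ ≤ ‖v‖ :=
  ((bddDeriv v k).norm_coe_le_norm x).trans (norm_le_pi_norm (jet v) k)

theorem abs_apply_le (v : PerC4 d X) (x : Euc d) : |v x| ≤ ‖v‖ := by
  have := norm_iteratedFDeriv_le v 0 x
  rwa [Fin.val_zero, norm_iteratedFDeriv_zero, Real.norm_eq_abs] at this

/-- Evaluation at a point as a continuous linear map. -/
def evalCLM (x : Euc d) : PerC4 d X →L[ℝ] ℝ :=
  LinearMap.mkContinuous
    { toFun := fun v => v x, map_add' := fun _ _ => rfl, map_smul' := fun _ _ => rfl } 1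
    fun v => by
      rw [one_mul]
      exact abs_apply_le v x

theorem continuous_eval : Continuous fun p : PerC4 d X × Euc d => p.1 p.2 := by
  refine continuous_iff_continuousAt.2 fun ⟨v, x⟩ => ?_
  have h1 : Filter.Tendsto (fun p : PerC4 d X × Euc d => ‖p.1 - v‖ + |v p.2 - v x|)
      (nhds (v, x)) (nhds 0) := by
    have hv := v.continuous_apply
    have : Continuous fun p : PerC4 d X × Euc d => ‖p.1 - v‖ + |v p.2 - v x| := by fun_prop
    simpa using this.tendsto (v, x)
  refine tendsto_iff_dist_tendsto_zero.2
    (squeeze_zero (fun _ => dist_nonneg) (fun p => ?_) h1)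
  rw [Real.dist_eq]
  have h2 := abs_apply_le (p.1 - v) p.2
  have h3 : p.1 p.2 - v x = (p.1 - v) p.2 + (v p.2 - v x) := by
    change _ = p.1 p.2 - v p.2 + _
    ring
  rw [h3]
  exact (abs_add_le _ _).trans (add_le_add_left h2 _)

/-- Restriction to the mesh as a continuous linear map. -/
def gridEval (N : ℕ) : PerC4 d X →L[ℝ] (Grid d N → ℝ) :=
  ContinuousLinearMap.pi fun i => evalCLM (gridPoint X N i)

end PerC4

theorem taylor_bounds {F : Type*} [NormedAddCommGroup F] [NormedSpace ℝ F] {T M : ℝ} (hT : 0 < T)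
    {u : ℝ → F} (hu : ContDiffOn ℝ 2 u (Icc 0 T))
    (hM : ∀ k ≤ 2, ∀ t ∈ Icc 0 T, ‖iteratedDerivWithin k u (Icc 0 T) t‖ ≤ M) :
    (∀ t ∈ Icc 0 T, HasDerivWithinAt u (derivWithin u (Icc 0 T) t) (Icc 0 T) t) ∧
    ContinuousOn (derivWithin u (Icc 0 T)) (Icc 0 T) ∧
    (∀ s ∈ Icc 0 T, ∀ t ∈ Icc 0 T, ‖u t - u s‖ ≤ M * |t - s|) ∧
    ∀ s ∈ Icc 0 T, ∀ t ∈ Icc 0 T, s ≤ t →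
      ‖u t - u s - (t - s) • derivWithin u (Icc 0 T) s‖ ≤ M * (t - s) ^ 2 := by
  have hud := uniqueDiffOn_Icc hT
  set u' := derivWithin u (Icc 0 T) with hu'
  have hd : ∀ t ∈ Icc 0 T, HasDerivWithinAt u (u' t) (Icc 0 T) t := fun t ht =>
    (hu.differentiableOn (by norm_num) t ht).hasDerivWithinAt
  have hu1 : ContDiffOn ℝ 1 u' (Icc 0 T) := hu.derivWithin hud (by norm_num)
  have hd1 : ∀ t ∈ Icc 0 T, HasDerivWithinAt u' (derivWithin u' (Icc 0 T) t) (Icc 0 T) t :=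
    fun t ht => (hu1.differentiableOn (by norm_num) t ht).hasDerivWithinAt
  have hM1 : ∀ t ∈ Icc 0 T, ‖u' t‖ ≤ M := by
    intro t ht
    have := hM 1 (by norm_num) t ht
    rwa [iteratedDerivWithin_one] at this
  have hM2 : ∀ t ∈ Icc 0 T, ‖derivWithin u' (Icc 0 T) t‖ ≤ M := by
    intro t ht
    have := hM 2 le_rfl t ht
    rwa [iteratedDerivWithin_succ, show iteratedDerivWithin 1 u (Icc 0 T) = u' from
      iteratedDerivWithin_one] at this
  have hLip1 : ∀ s ∈ Icc 0 T, ∀ t ∈ Icc 0 T, ‖u' t - u' s‖ ≤ M * |t - s| := fun s hs t ht =>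
    (convex_Icc 0 T).norm_image_sub_le_of_norm_hasDerivWithin_le hd1 hM2 hs ht
  refine ⟨hd, hu1.continuousOn, fun s hs t ht =>
    (convex_Icc 0 T).norm_image_sub_le_of_norm_hasDerivWithin_le hd hM1 hs ht,
    fun s hs t ht hst => ?_⟩
  have hsub : Icc s t ⊆ Icc 0 T := Icc_subset_Icc hs.1 ht.2
  have hM0 : 0 ≤ M := (norm_nonneg _).trans (hM1 s hs)
  have h1 : ∀ r ∈ Icc s t,
      HasDerivWithinAt (fun r => u r - r • u' s) (u' r - u' s) (Icc s t) r := by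
    intro r hr
    have h2 := ((hd r (hsub hr)).mono hsub).sub
      ((hasDerivWithinAt_id r (Icc s t)).smul_const (u' s))
    rw [one_smul] at h2
    exact h2
  have h2 := (convex_Icc s t).norm_image_sub_le_of_norm_hasDerivWithin_le h1
    (C := M * (t - s)) (fun r hr => (hLip1 s hs r (hsub hr)).trans (by
      rw [abs_of_nonneg (by linarith [hr.1])]
      gcongr
      exact hr.2)) (left_mem_Icc.2 hst) (right_mem_Icc.2 hst)
  have h3 : u t - u s - (t - s) • u' s = u t - t • u' s - (u s - s • u' s) := by
    rw [sub_smul]; abel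
  rw [h3]
  calc _ ≤ _ := h2
    _ = _ := by rw [Real.norm_eq_abs, abs_of_nonneg (by linarith)]; ring

/-- The error of linear interpolation in time for the reaction term. -/
theorem abs_reaction_interp_le {κ a b c p s τ M : ℝ} (hκ : 2 ≤ κ) (hτ : 0 < τ)
    (hs : s ∈ Icc 0 τ) (ha : |a| ≤ 1) (hb : |b| ≤ 1) (hc : |c| ≤ 1)
    (hba : |b - a| ≤ M * τ) (hca : |c - a| ≤ M * τ)
    (hbp : |b - a - s * p| ≤ M * τ ^ 2) (hcp : |c - a - τ * p| ≤ M * τ ^ 2) :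
    |(1 - s / τ) * ((κ + 1) * a - a ^ 3) + s / τ * ((κ + 1) * c - c ^ 3)
        - ((κ + 1) * b - b ^ 3)| ≤ (2 * (κ + 1) * M + 10 * M ^ 2) * τ ^ 2 := by
  set σ := s / τ with hσ
  have hσ0 : 0 ≤ σ := div_nonneg hs.1 hτ.le
  have hσ1 : σ ≤ 1 := (div_le_one hτ).2 hs.2
  have hsσ : s = σ * τ := by rw [hσ]; field_simp
  -- Both values are expanded about `a` by f(z) - f(a) = f'(a)(z-a) - (z-a)²(2a+z); the slope `p`
  -- cancels because s = στ.
  have e : (1 - σ) * ((κ + 1) * a - a ^ 3) + σ * ((κ + 1) * c - c ^ 3) - ((κ + 1) * b - b ^ 3)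
      = (κ + 1 - 3 * a ^ 2) * (σ * (c - a - τ * p) - (b - a - s * p))
        - σ * ((c - a) ^ 2 * (2 * a + c)) + (b - a) ^ 2 * (2 * a + b) := by
    rw [hsσ]; ring
  have ha2 : a ^ 2 ≤ 1 := by
    have := abs_le.1 ha
    nlinarith
  have hquad : ∀ z, |z| ≤ 1 → |z - a| ≤ M * τ →
      |(z - a) ^ 2 * (2 * a + z)| ≤ 3 * (M ^ 2 * τ ^ 2) := by
    intro z hz hza
    have h1 : (z - a) ^ 2 ≤ (M * τ) ^ 2 := sq_le_sq.2 (hza.trans (le_abs_self _))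
    have h2 : |2 * a + z| ≤ 3 := by
      rw [abs_le] at *
      constructor <;> linarith
    rw [abs_mul, abs_of_nonneg (sq_nonneg _)]
    calc _ ≤ (M * τ) ^ 2 * 3 := by gcongr
      _ = _ := by ring
  have h1 : |(κ + 1 - 3 * a ^ 2) * (σ * (c - a - τ * p) - (b - a - s * p))|
      ≤ (κ + 1) * (2 * (M * τ ^ 2)) := by
    rw [abs_mul]
    have h2 : |κ + 1 - 3 * a ^ 2| ≤ κ + 1 := by
      rw [abs_le]; constructor <;> nlinarith [sq_nonneg a]
    have h3 : |σ * (c - a - τ * p) - (b - a - s * p)| ≤ 2 * (M * τ ^ 2) := by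
      calc _ ≤ _ := abs_sub _ _
        _ ≤ 1 * (M * τ ^ 2) + M * τ ^ 2 := by
          rw [abs_mul, abs_of_nonneg hσ0]
          gcongr
        _ = _ := by ring
    gcongr
  have h4 : |σ * ((c - a) ^ 2 * (2 * a + c))| ≤ 1 * (3 * (M ^ 2 * τ ^ 2)) := by
    rw [abs_mul, abs_of_nonneg hσ0]
    have := hquad c hc hca
    gcongr
  have h5 := hquad b hb hba
  have h6 : 0 ≤ M ^ 2 * τ ^ 2 := by positivity
  rw [e]
  calc _ ≤ _ := (abs_add_le _ _).trans (add_le_add_left (abs_sub _ _) _)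
    _ ≤ (κ + 1) * (2 * (M * τ ^ 2)) + 1 * (3 * (M ^ 2 * τ ^ 2)) + 3 * (M ^ 2 * τ ^ 2) :=
      add_le_add (add_le_add h1 h4) h5
    _ ≤ _ := by linarith

/-! ### Pointwise consequences of the equation. -/

section Solution

variable {X T ε δ : ℝ} [hX : Fact (0 < X)] {ρ : ℝ → ℝ} {u₀ : Euc d → ℝ} {u : ℝ → PerC4 d X}

theorem gridPoint_mem_closedCube (N : ℕ) [NeZero N] (i : Grid d N) :
    gridPoint X N i ∈ closedCube d X := by
  intro k
  have hX0 := hX.out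
  have hN : (0 : ℝ) < N := by exact_mod_cast NeZero.pos N
  have h1 : gridPoint X N i k = X / N * (i k).val := by simp [gridPoint, meshPoint]
  have h2 : ((i k).val : ℝ) ≤ N := by exact_mod_cast (ZMod.val_lt (i k)).le
  rw [h1]
  refine ⟨by positivity, ?_⟩
  calc X / N * (i k).val ≤ X / N * N := by gcongr
    _ = X := by field_simp

/-- Continuity extends the equation to the boundary of the cube, where the maximum may be attained
and where mesh nodes lie. -/
theorem IsNACSolution.equation_closedCube (hρ : IsKernel d δ ρ) (hu : IsNACSolution ε δ ρ T u₀ u)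
    (hd : ∀ t ∈ Icc 0 T, HasDerivWithinAt u (derivWithin u (Icc 0 T) t) (Icc 0 T) t) :
    ∀ t ∈ Ioo 0 T, ∀ x ∈ closedCube d X, derivWithin u (Icc 0 T) t x
      = ε ^ 2 * nonlocalOp δ ρ (u t) x - (u t x) ^ 3 + u t x := by
  intro t ht
  have hsub : openCube d X ⊆ {x | derivWithin u (Icc 0 T) t x
      = ε ^ 2 * nonlocalOp δ ρ (u t) x - (u t x) ^ 3 + u t x} := by
    intro x hx
    have h1 := hu.equation t ht x hx
    have h2 : HasDerivAt u (derivWithin u (Icc 0 T) t) t :=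
      (hd t (Ioo_subset_Icc_self ht)).hasDerivAt (Icc_mem_nhds ht.1 ht.2)
    have h3 : HasDerivAt (fun s => u s x) (derivWithin u (Icc 0 T) t x) t :=
      (PerC4.evalCLM x).hasFDerivAt.comp_hasDerivAt t h2
    rw [h3.deriv] at h1
    change _ = _
    linarith
  have hc1 := (derivWithin u (Icc 0 T) t).continuous_apply
  have hc2 := (u t).continuous_apply
  have hc3 : Continuous (nonlocalOp δ ρ (u t)) :=
    continuous_nonlocalOp hρ ((u t).2.1.of_le (by norm_num)) ((u t).norm_iteratedFDeriv_le 2)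
  exact (closedCube_subset_closure hX.out).trans
    (closure_minimal hsub (isClosed_eq hc1 (by fun_prop)))

theorem IsNACSolution.abs_le_one (hT : 0 < T) (hρ : IsKernel d δ ρ)
    (hu : IsNACSolution ε δ ρ T u₀ u) (huc : ContinuousOn u (Icc 0 T))
    (hd : ∀ t ∈ Icc 0 T, HasDerivWithinAt u (derivWithin u (Icc 0 T) t) (Icc 0 T) t)
    (h0 : eLpNorm u₀ ∞ (volume.restrict (openCube d X)) ≤ 1) :
    ∀ t ∈ Icc 0 T, ∀ x, |u t x| ≤ 1 := by
  have hinit := abs_le_one_of_eLpNorm_le hX.out (u 0).continuous_apply hu.initial h0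
  have heq := hu.equation_closedCube hρ hd
  have hder : ∀ t ∈ Ioo 0 T, ∀ x,
      HasDerivAt (fun s => u s x) (derivWithin u (Icc 0 T) t x) t := fun t ht x =>
    (PerC4.evalCLM x).hasFDerivAt.comp_hasDerivAt t
      ((hd t (Ioo_subset_Icc_self ht)).hasDerivAt (Icc_mem_nhds ht.1 ht.2))
  have hc : ContinuousOn (fun p : ℝ × Euc d => u p.1 p.2) (Icc 0 T ×ˢ univ) :=
    PerC4.continuous_eval.comp_continuousOn (f := fun p : ℝ × Euc d => (u p.1, p.2))
      ((huc.comp continuousOn_fst fun p hp => hp.1).prodMk continuousOn_snd)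
  intro t ht x
  refine abs_le.2 ⟨?_, le_one_of_nonlocalAllenCahn (w := fun t => (u t).1) hX.out hT hρ hc
    (fun t => (u t).2.2) hder heq (fun x hx => (abs_le.1 (hinit x hx)).2) t ht x⟩
  have := le_one_of_nonlocalAllenCahn (w := fun t x => -u t x)
    (w' := fun t x => -derivWithin u (Icc 0 T) t x) (ε := ε) hX.out hT hρ hc.neg
    (fun t i x => congrArg Neg.neg ((u t).2.2 i x)) (fun t ht x => (hder t ht x).neg)
    (fun t ht x hx => by rw [nonlocalOp_neg, heq t ht x hx]; ring)
    (fun x hx => by linarith [(abs_le.1 (hinit x hx)).1]) t ht x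
  linarith

end Solution

end

/-! ### Assembly of the error estimate. -/

theorem mainTheorem4 (d : ℕ) (hd : 0 < d) (ε κ M : ℝ) (hε : 0 < ε) (hκ : 2 ≤ κ) :
    ∃ C : ℝ, 0 < C ∧
      ∀ (X : ℝ) [Fact (0 < X)] (T : ℝ), 0 < T →
      ∀ (δ : ℝ), 0 < δ →
      ∀ (ρ : ℝ → ℝ), IsKernel d δ ρ →
      ∀ (u₀ : Euc d → ℝ) (u : ℝ → PerC4 d X),
        ContDiffOn ℝ 2 u (Icc 0 T) →
        (∀ k ≤ 2, ∀ t ∈ Icc 0 T, ‖iteratedDerivWithin k u (Icc 0 T) t‖ ≤ M) →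
        IsNACSolution ε δ ρ T u₀ u →
        eLpNorm u₀ ∞ (volume.restrict (openCube d X)) ≤ 1 →
      ∀ (N : ℕ) [NeZero N] (K : ℕ) (h τ : ℝ), 0 < K → h = X / N → τ = T / K → τ ≤ 1 →
      ∀ (U : ℕ → Grid d N → ℝ),
        U 0 = gridRestrict X N u₀ →
        (∀ n < K, U (n + 1) = etdrk2Step (stabMatrix d N X δ ρ ε κ) κ τ (U n)) →
      ∀ n ≤ K, ‖U n - gridRestrict X N (u (n * τ))‖ ≤
        C * Real.exp (n * τ) * (h ^ 2 + τ ^ 2) := by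
  have hκ0 : 0 < κ := by linarith
  -- The summands are the cubic excess, `Q`, (κ+1)P and the spatial residual. The absolute value of
  -- `M` keeps the constant positive before the bounds on `u` force `M ≥ 0`.
  refine ⟨κ ^ 2 + (2 * (κ + 1) * |M| + 10 * |M| ^ 2) + (κ + 1) * ((κ + 1) * |M|)
    + (κ + 2) * (ε ^ 2 * (864 * d ^ 3 * |M|)), by positivity, ?_⟩
  intro X hX T hT δ _ ρ hρ u₀ u hu hM hsol hu₀ N _ K h τ hK hh hτdef hτ1 U hU0 hU
  subst hh
  have hM0 : 0 ≤ M := (norm_nonneg _).trans (hM 0 (by norm_num) 0 ⟨le_rfl, hT.le⟩)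
  rw [abs_of_nonneg hM0]
  have hK0 : (0 : ℝ) < K := by exact_mod_cast hK
  have hτ : 0 < τ := by rw [hτdef]; positivity
  have hKτ : K * τ = T := by rw [hτdef]; field_simp
  obtain ⟨hder, hdc, hLip, hTay⟩ := taylor_bounds hT hu hM
  set u' := derivWithin u (Icc 0 T) with hu'
  have hu1 := hsol.abs_le_one hT hρ hu.continuousOn hder hu₀
  have heq := hsol.equation_closedCube hρ hder
  have hnorm : ∀ t ∈ Icc 0 T, ‖u t‖ ≤ M := by
    intro t ht
    simpa using hM 0 (by norm_num) t ht
  set L := stabMatrix d N X δ ρ ε κ with hL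
  obtain ⟨w, hw⟩ := exists_norm_smul_sub_stabMatrix_le N X hρ ε κ (d := d)
  have hS : ∀ t, 0 ≤ t → ‖semigroup L t‖ ≤ Real.exp (-κ * t) := fun t ht =>
    norm_semigroup_le hw ht
  have hU1 : ∀ n ≤ K, ‖U n‖ ≤ 1 := by
    intro n
    induction n with
    | zero =>
      intro _
      rw [hU0]
      refine (pi_norm_le_iff_of_nonneg zero_le_one).2 fun i => ?_
      have h1 := hu1 0 ⟨le_rfl, hT.le⟩ (gridPoint X N i)
      rwa [hsol.initial _ (gridPoint_mem_closedCube N i)] at h1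
    | succ n ih =>
      intro hn
      rw [hU n (by omega)]
      exact norm_etdrk2Step_le hκ hτ hS (ih (by omega))
  have hE0 : ‖U 0 - gridRestrict X N (u ((0 : ℕ) * τ))‖ ≤ 0 := by
    rw [Nat.cast_zero, zero_mul, hU0]
    refine (pi_norm_le_iff_of_nonneg le_rfl).2 fun i => ?_
    have h1 := hsol.initial _ (gridPoint_mem_closedCube N i)
    have h2 : (gridRestrict X N u₀ - gridRestrict X N (u 0)) i = 0 :=
      sub_eq_zero.2 h1.symm
    rw [h2, norm_zero]
  set c := (κ ^ 2 + (2 * (κ + 1) * M + 10 * M ^ 2) + (κ + 1) * ((κ + 1) * M)) * τ ^ 2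
    + (κ + 2) * (ε ^ 2 * (864 * d ^ 3 * M * (X / N) ^ 2)) with hc
  have hc0 : 0 ≤ c := by positivity
  have key := le_mul_exp_of_step (K := K) (τ := τ) hc0
    (E := fun n => ‖U n - gridRestrict X N (u (n * τ))‖) hE0 fun n hn => ?_
  · intro n hn
    refine (key n hn).trans ?_
    have hle : c ≤ (κ ^ 2 + (2 * (κ + 1) * M + 10 * M ^ 2) + (κ + 1) * ((κ + 1) * M)
        + (κ + 2) * (ε ^ 2 * (864 * d ^ 3 * M))) * ((X / N) ^ 2 + τ ^ 2) := by
      have e1 : 0 ≤ (κ ^ 2 + (2 * (κ + 1) * M + 10 * M ^ 2) + (κ + 1) * ((κ + 1) * M))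
        * (X / N) ^ 2 := by positivity
      have e2 : 0 ≤ (κ + 2) * (ε ^ 2 * (864 * d ^ 3 * M)) * τ ^ 2 := by positivity
      rw [hc]
      linarith
    calc _ ≤ _ := mul_le_mul_of_nonneg_right hle (Real.exp_pos (n * τ)).le
      _ = _ := by ring
  · have ht : ∀ s ∈ Icc 0 τ, n * τ + s ∈ Icc 0 T := by
      intro s hs
      have h1 : ((n : ℝ) + 1) * τ ≤ K * τ := by
        have : (n : ℝ) + 1 ≤ K := by exact_mod_cast hn
        gcongr
      have h2 : 0 ≤ n * τ := by positivity
      exact ⟨by linarith [hs.1], by linarith [hs.2]⟩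
    have ht' : ∀ s ∈ Ioo 0 τ, n * τ + s ∈ Ioo 0 T := by
      intro s hs
      have h1 := ht τ ⟨hτ.le, le_rfl⟩
      have h2 : 0 ≤ n * τ := by positivity
      exact ⟨by linarith [hs.1], by linarith [hs.2, h1.2]⟩
    have hmaps : MapsTo (fun s => n * τ + s) (Icc 0 τ) (Icc 0 T) := ht
    have hsh : ContinuousOn (fun s : ℝ => n * τ + s) (Icc 0 τ) := by fun_prop
    have hm0 : (0 : ℝ) ∈ Icc 0 τ := ⟨le_rfl, hτ.le⟩
    have hmτ : τ ∈ Icc 0 τ := ⟨hτ.le, le_rfl⟩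
    have hbd : ∀ s ∈ Icc 0 τ, ‖gridRestrict X N (u (n * τ + s))‖ ≤ 1 := fun s hs =>
      (pi_norm_le_iff_of_nonneg zero_le_one).2 fun i => hu1 _ (ht s hs) (gridPoint X N i)
    have hdiff : ∀ s ∈ Icc 0 τ, ∀ x, |u (n * τ + s) x - u (n * τ + 0) x| ≤ M * τ := by
      intro s hs x
      have h1 := hLip _ (ht 0 hm0) _ (ht s hs)
      rw [add_sub_add_left_eq_sub, sub_zero, abs_of_nonneg hs.1] at h1
      calc _ ≤ _ := PerC4.abs_apply_le (u (n * τ + s) - u (n * τ + 0)) x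
        _ ≤ _ := h1
        _ ≤ M * τ := by gcongr; exact hs.2
    have hdiff2 : ∀ s ∈ Icc 0 τ, ∀ x,
        |u (n * τ + s) x - u (n * τ + 0) x - s * u' (n * τ + 0) x| ≤ M * τ ^ 2 := by
      intro s hs x
      have h1 := hTay _ (ht 0 hm0) _ (ht s hs) (by linarith [hs.1])
      rw [add_sub_add_left_eq_sub, sub_zero] at h1
      calc _ ≤ _ :=
            PerC4.abs_apply_le (u (n * τ + s) - u (n * τ + 0) - s • u' (n * τ + 0)) x
        _ ≤ _ := h1
        _ ≤ M * τ ^ 2 := by have := hs.1; gcongr; exact hs.2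
    have step := norm_etdrk2Step_sub_le (L := L) hκ hτ hτ1 hS
      (y := fun s => gridRestrict X N (u (n * τ + s)))
      (y' := fun s => gridRestrict X N (u' (n * τ + s)))
      ((PerC4.gridEval N).continuous.comp_continuousOn (hu.continuousOn.comp hsh hmaps))
      ((PerC4.gridEval N).continuous.comp_continuousOn (hdc.comp hsh hmaps))
      (fun s hs => by
        have h1 : HasDerivAt u (u' (n * τ + s)) (n * τ + s) :=
          (hder _ (Ioo_subset_Icc_self (ht' s hs))).hasDerivAt
            (Icc_mem_nhds (ht' s hs).1 (ht' s hs).2)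
        exact (PerC4.gridEval N).hasFDerivAt.comp_hasDerivAt s (h1.comp_const_add (n * τ) s))
      (hU1 n hn.le) hbd
      (P := (κ + 1) * M) (Q := 2 * (κ + 1) * M + 10 * M ^ 2)
      (R := ε ^ 2 * (864 * d ^ 3 * M * (X / N) ^ 2))
      (fun s hs => by
        refine (norm_reaction_sub_le hκ (hbd s hs) (hbd 0 hm0)).trans ?_
        rw [mul_assoc]
        gcongr
        exact (pi_norm_le_iff_of_nonneg (by positivity)).2 fun i => hdiff s hs (gridPoint X N i))
      (fun s hs => (pi_norm_le_iff_of_nonneg (by positivity)).2 fun i =>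
        abs_reaction_interp_le hκ hτ hs (hu1 _ (ht 0 hm0) _) (hu1 _ (ht s hs) _)
          (hu1 _ (ht τ hmτ) _) (hdiff s hs _) (hdiff τ hmτ _) (hdiff2 s hs _)
          (hdiff2 τ hmτ (gridPoint X N i)))
      (fun s hs => (pi_norm_le_iff_of_nonneg (by positivity)).2 fun i => by
        have h1 := heq _ (ht' s hs) _ (gridPoint_mem_closedCube (X := X) N i)
        have hsI := Ioo_subset_Icc_self (ht' s hs)
        have h2 := abs_discreteOp_sub_nonlocalOp_le hX.out hρ (u (n * τ + s)).2.1
          (u (n * τ + s)).2.2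
          (fun y => ((u (n * τ + s)).norm_iteratedFDeriv_le 2 y).trans (hnorm _ hsI))
          (fun y => ((u (n * τ + s)).norm_iteratedFDeriv_le 4 y).trans (hnorm _ hsI)) i
        -- The `κ` terms of `L_h` and of the reaction cancel, so the residual is exactly the spatial
        -- consistency error.
        have h3 : (gridRestrict X N (u' (n * τ + s)) + L.mulVec (gridRestrict X N (u (n * τ + s)))
            - reaction κ (gridRestrict X N (u (n * τ + s)))) i
            = -(ε ^ 2 * (discreteOp d N X δ ρ (gridRestrict X N (u (n * τ + s))) i
              - nonlocalOp δ ρ (u (n * τ + s)) (gridPoint X N i))) := by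
          rw [hL, stabMatrix_mulVec]
          simp only [Pi.sub_apply, Pi.add_apply, Pi.neg_apply, Pi.smul_apply, smul_eq_mul,
            reaction]
          change u' (n * τ + s) (gridPoint X N i) + (_ + κ * u (n * τ + s) (gridPoint X N i))
            - ((κ + 1) * u (n * τ + s) (gridPoint X N i)
              - u (n * τ + s) (gridPoint X N i) ^ 3) = _
          rw [h1]
          ring
        rw [h3, norm_neg, norm_mul, Real.norm_eq_abs, Real.norm_eq_abs,
          abs_of_nonneg (by positivity)]
        gcongr)
    rw [hU n hn]
    have h4 : ((n + 1 : ℕ) : ℝ) * τ = n * τ + τ := by push_cast; ring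
    rw [h4]
    simpa only [add_zero] using step
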